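/- For integers $K^A,K^B\ge 1$ and $p\in[0,1]$, let $U(p)$ be the following random two-player game in which the action sets of the players $A$ and $B$ are $\{1,\dots,K^A\}$ and $\{1,\dots,K^B\}$. Let $U^A(a,b)$ and $V(a,b)$, over all action profiles $(a,b)$, be i.i.d. uniform on $[0,1]$, and let $C(a,b)$ be i.i.d. Bernoulli($p$) variables independent of them. Player $A$'s payoff at $(a,b)$ is $U^A(a,b)$. Player $B$'s payoff is $U^B(a,b)=U^A(a,b)$ if $C(a,b)=1$, and $U^B(a,b)=V(a,b)$ otherwise. A profile $(a^*,b^*)$ is a pure Nash equilibrium if $U^A(a^*,b^*)\ge U^A(a,b^*)$ for all $a$ and $U^B(a^*,b^*)\ge U^B(a^*,b)$ for all $b$. Best-response dynamics is the process $\mathrm{BRD}(t)$, $t=0,1,2,\dots$, with $\mathrm{BRD}(0)=(1,1)$ defined as follows. Suppose $\mathrm{BRD}(t)=(a',b')$. If $t$ is even, then $\mathrm{BRD}(t+1)=(a'',b')$ with $a''\in(\arg\max_a U^A(a,b'))\setminus\{a'\}$ if this set is non-empty, and $\mathrm{BRD}(t+1)=(a',b')$ otherwise. If $t$ is odd, then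 $\mathrm{BRD}(t+1)=(a',b'')$ with $b''\in(\arg\max_b U^B(a',b))\setminus\{b'\}$ if this set is non-empty, and $\mathrm{BRD}(t+1)=(a',b')$ otherwise. (Almost surely there are no ties, so the process is determined by the payoffs.) Let $\tau^{\mathrm{NE}}\in\{0,1,2,\dots\}\cup\{\infty\}$ be the first time $t$ at which $\mathrm{BRD}(t)$ is a pure Nash equilibrium, with $\tau^{\mathrm{NE}}=\infty$ if there is no such time. **Theorem.** Let $(K^A_n)$ and $(K^B_n)$ be sequences of positive integers that diverge to $\infty$, and let $(p_n)$ be a sequence in $(0,1]$ with $$\lim_{n\to\infty}\frac{\log p_n}{\log \min(K^A_n,K^B_n)}=0 .$$ Let $\tau^{\mathrm{NE}}_n$ be the time $\tau^{\mathrm{NE}}$ for the game $U(p_n)$ with $K^A_n$ and $K^B_n$ actions. Then $$\lim_{n\to\infty}\mathsf P\left(\tau^{\mathrm{NE}}_n=\infty\right)=0 .$$ -/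

import Mathlib

open Filter Topology MeasureTheory

/-- A two-person normal-form game with action sets `α` (player A) and `β` (player B), given by its
payoff bimatrix. -/
structure BimatrixGame (α β : Type) where
  /-- payoff function of player A -/
  payA : α → β → ℝ
  /-- payoff function of player B -/
  payB : α → β → ℝ

namespace BimatrixGame

variable {α β : Type}

/-- The set of pure Nash equilibria. -/
def pureNash (G : BimatrixGame α β) : Set (α × β) :=
  {x | (∀ a, G.payA a x.2 ≤ G.payA x.1 x.2) ∧ (∀ b, G.payB x.1 b ≤ G.payB x.1 x.2)}

/-- `argmax_a U^A(a, b)`. -/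
def argmaxA (G : BimatrixGame α β) (b : β) : Set α :=
  {a | ∀ a', G.payA a' b ≤ G.payA a b}

/-- `argmax_b U^B(a, b)`. -/
def argmaxB (G : BimatrixGame α β) (a : α) : Set β :=
  {b | ∀ b', G.payB a b' ≤ G.payB a b}

open Classical in
/-- One revision by player A: move to an element of `argmax_a U^A(a, b) \ {current action}` if this
set is non-empty, otherwise stay. (Without ties there is never a choice to make.) -/
noncomputable def stepA (G : BimatrixGame α β) (x : α × β) : α × β :=
  if h : (G.argmaxA x.2 \ {x.1}).Nonempty then (h.some, x.2) else x

open Classical in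
/-- One revision by player B, likewise. -/
noncomputable def stepB (G : BimatrixGame α β) (x : α × β) : α × β :=
  if h : (G.argmaxB x.1 \ {x.2}).Nonempty then (x.1, h.some) else x

/-- Best-response dynamics started at `x₀`: player A revises at even times, player B at odd
times. -/
noncomputable def brd (G : BimatrixGame α β) (x₀ : α × β) : ℕ → α × β
  | 0 => x₀
  | t + 1 => if Even t then G.stepA (G.brd x₀ t) else G.stepB (G.brd x₀ t)

/-- The first time at which the best-response dynamics started at `x₀` visits a pure Nash
equilibrium; it is `⊤` (infinity) if this never happens. -/
noncomputable def nashTime (G : BimatrixGame α β) (x₀ : α × β) : ℕ∞ :=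
  ⨅ (t : ℕ) (_ : G.brd x₀ t ∈ G.pureNash), (t : ℕ∞)

end BimatrixGame

/-- The uniform distribution on `[0, 1]`. -/
noncomputable def unifMeasure : Measure ℝ := volume.restrict (Set.Icc (0 : ℝ) 1)

/-- The Bernoulli distribution of a coin that is `true` with probability `p`. -/
noncomputable def coinMeasure (p : ℝ) : Measure Bool :=
  ENNReal.ofReal p • Measure.dirac true + ENNReal.ofReal (1 - p) • Measure.dirac false

/-- For every action profile: the payoff of A, a provisional payoff of B, and a coin. -/
abbrev GameSample (α β : Type) : Type := α × β → ℝ × ℝ × Bool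

/-- All the provisional payoffs are i.i.d. uniform on `[0, 1]`, and the coins are i.i.d. Bernoulli
with parameter `p`, independent of the payoffs. -/
noncomputable def gameMeasure (α β : Type) [Fintype α] [Fintype β] (p : ℝ) :
    Measure (GameSample α β) :=
  Measure.pi fun _ => unifMeasure.prod (unifMeasure.prod (coinMeasure p))

/-- The random game `U(p)`: at every profile whose coin is `true` the payoff of B is replaced by
that of A. -/
def randomGame {α β : Type} (ω : GameSample α β) : BimatrixGame α β where
  payA a b := (ω (a, b)).1
  payB a b := if (ω (a, b)).2.2 then (ω (a, b)).1 else (ω (a, b)).2.1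

theorem isProbabilityMeasure_unifMeasure : IsProbabilityMeasure unifMeasure :=
  ⟨by simp [unifMeasure]⟩

theorem isProbabilityMeasure_coinMeasure {p : ℝ} (h0 : 0 ≤ p) (h1 : p ≤ 1) :
    IsProbabilityMeasure (coinMeasure p) :=
  ⟨by simp [coinMeasure, ← ENNReal.ofReal_add h0 (sub_nonneg.2 h1)]⟩

theorem isProbabilityMeasure_gameMeasure (α β : Type) [Fintype α] [Fintype β] {p : ℝ}
    (h0 : 0 ≤ p) (h1 : p ≤ 1) : IsProbabilityMeasure (gameMeasure α β p) := by
  have := isProbabilityMeasure_unifMeasure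
  have := isProbabilityMeasure_coinMeasure h0 h1
  unfold gameMeasure
  infer_instance

/-! If the dynamics never meets an equilibrium, it yields columns `b t` and rows `a t`, with `b 0`
the starting column, `a t` a best response to `b t`, `b (t + 1)` a best response to `a t`, and
consecutive terms distinct (`exists_best_response_sequences`). Among the first `n` steps, either no
row or column repeats, or there is a first return to an earlier row or column
(`injOn_or_exists_return`). With `K` the smaller number of actions, both alternatives are unlikely.

A return at step `j` imposes one more best-response condition than there are free actions. Each
condition costs about the reciprocal of the number of actions it ranges over, so a union bound over
paths leaves at most about `n / K`. Summed over `j < n`, this is of order `n ^ 2 / K`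
(`measureReal_row_return_le`, `measureReal_column_return_le`).

For a path without repetition, each corner `(a i, b i)` is maximal for one payoff in its column, yet
must be beaten in its row for the other payoff. With probability `p` the two payoffs agree, so the
value to be beaten is already a maximum. If rows are at least as numerous as columns, this saves a
factor of about `1 - p / 2` per corner, and `k` corners give at most about `K * exp (-p k / 3)`
(`measureReal_corners_le`, `measureReal_path_le`). Otherwise the players are exchanged.

Since `p` decays more slowly than any power of `K`, taking `k` close to `K ^ (1 / 4)` makes both
bounds vanish. Only weak inequalities between payoffs are used, so ties need no separate treatment.
-/

/-! ### Conditioning and independence in finite product measures. -/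

namespace ProductMeasure

variable {ι Ω : Type} [Fintype ι] [DecidableEq ι] [MeasurableSpace Ω]

/-- Resampling one coordinate independently preserves the product law; this is what permits
conditioning on the value at `u`. -/
theorem map_update (ν : Measure Ω) [IsProbabilityMeasure ν] (u : ι) :
    ((ν.prod (Measure.pi fun _ : ι => ν)).map fun z => Function.update z.2 u z.1) =
      Measure.pi fun _ : ι => ν := by
  refine (Measure.pi_eq fun s hs => ?_).symm
  have hm : Measurable fun z : Ω × (ι → Ω) => Function.update z.2 u z.1 := by
    rw [measurable_pi_iff]
    intro v
    by_cases h : v = u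
    · subst h; simpa using measurable_fst
    · simp only [Function.update_of_ne h]; fun_prop
  rw [Measure.map_apply hm (.univ_pi hs)]
  have : (fun z : Ω × (ι → Ω) => Function.update z.2 u z.1) ⁻¹' Set.univ.pi s =
      s u ×ˢ Set.univ.pi (Function.update s u Set.univ) := by
    ext z
    simp only [Set.mem_preimage, Set.mem_univ_pi, Set.mem_prod]
    constructor
    · intro h
      refine ⟨by simpa using h u, fun v => ?_⟩
      by_cases hv : v = u
      · subst hv; simp
      · simpa [hv] using h v
    · rintro ⟨h1, h2⟩ v
      by_cases hv : v = u
      · subst hv; simpa using h1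
      · simpa [hv] using h2 v
  rw [this, Measure.prod_prod, Measure.pi_pi, ← Finset.mul_prod_erase _ _ (Finset.mem_univ u),
    ← Finset.mul_prod_erase _ (fun i => ν (s i)) (Finset.mem_univ u)]
  simp only [Function.update_self, measure_univ, one_mul]
  congr 1
  refine Finset.prod_congr rfl fun v hv => ?_
  rw [Function.update_of_ne (Finset.ne_of_mem_erase hv)]

theorem measure_eq_lintegral_update (ν : Measure Ω) [IsProbabilityMeasure ν] (u : ι)
    {E : Set (ι → Ω)} (hE : MeasurableSet E) :
    Measure.pi (fun _ : ι => ν) E =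
      ∫⁻ x, Measure.pi (fun _ : ι => ν) {ω | Function.update ω u x ∈ E} ∂ν := by
  have hm : Measurable fun z : Ω × (ι → Ω) => Function.update z.2 u z.1 := by
    rw [measurable_pi_iff]
    intro v
    by_cases h : v = u
    · subst h; simpa using measurable_fst
    · simp only [Function.update_of_ne h]; fun_prop
  conv_lhs => rw [← map_update ν u, Measure.map_apply hm hE, Measure.prod_apply (hm hE)]
  rfl

/-- Gluing two independent copies along `S` preserves the law. Events determined by disjoint sets of
coordinates then live on different copies, hence are independent. -/
theorem map_piecewise (ν : Measure Ω) [IsProbabilityMeasure ν] (S : Finset ι) :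
    (((Measure.pi fun _ : ι => ν).prod (Measure.pi fun _ : ι => ν)).map
      fun z => S.piecewise z.1 z.2) = Measure.pi fun _ : ι => ν := by
  refine (Measure.pi_eq fun s hs => ?_).symm
  have hm : Measurable fun z : (ι → Ω) × (ι → Ω) => S.piecewise z.1 z.2 := by
    rw [measurable_pi_iff]
    intro v
    by_cases h : v ∈ S
    · simp only [Finset.piecewise_eq_of_mem _ _ _ h]; fun_prop
    · simp only [Finset.piecewise_eq_of_notMem _ _ _ h]; fun_prop
  rw [Measure.map_apply hm (.univ_pi hs)]
  have : (fun z : (ι → Ω) × (ι → Ω) => S.piecewise z.1 z.2) ⁻¹' Set.univ.pi s =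
      Set.univ.pi (S.piecewise s fun _ => Set.univ) ×ˢ
        Set.univ.pi (S.piecewise (fun _ => Set.univ) s) := by
    ext z
    simp only [Set.mem_preimage, Set.mem_univ_pi, Set.mem_prod, ← forall_and]
    refine forall_congr' fun v => ?_
    by_cases h : v ∈ S <;> simp [h]
  rw [this, Measure.prod_prod, Measure.pi_pi, Measure.pi_pi, ← Finset.prod_mul_distrib]
  refine Finset.prod_congr rfl fun v _ => ?_
  by_cases h : v ∈ S <;> simp [h]

/-- Membership in `E` is determined by the coordinates in `S`. -/
def DeterminedBy (E : Set (ι → Ω)) (S : Finset ι) : Prop :=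
  ∀ ⦃ω ω' : ι → Ω⦄, (∀ v ∈ S, ω v = ω' v) → ω ∈ E → ω' ∈ E

omit [Fintype ι] [DecidableEq ι] [MeasurableSpace Ω] in
theorem DeterminedBy.mem_iff {E : Set (ι → Ω)} {S : Finset ι} (h : DeterminedBy E S)
    {ω ω' : ι → Ω} (hω : ∀ v ∈ S, ω v = ω' v) : ω ∈ E ↔ ω' ∈ E :=
  ⟨h hω, h fun v hv => (hω v hv).symm⟩

theorem measure_inter_of_disjoint (ν : Measure Ω) [IsProbabilityMeasure ν] {S T : Finset ι}
    (hST : Disjoint S T) {E F : Set (ι → Ω)} (hE : MeasurableSet E) (hF : MeasurableSet F)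
    (hES : DeterminedBy E S) (hFT : DeterminedBy F T) :
    Measure.pi (fun _ : ι => ν) (E ∩ F) =
      Measure.pi (fun _ : ι => ν) E * Measure.pi (fun _ : ι => ν) F := by
  have hm : Measurable fun z : (ι → Ω) × (ι → Ω) => S.piecewise z.1 z.2 := by
    rw [measurable_pi_iff]
    intro v
    by_cases h : v ∈ S
    · simp only [Finset.piecewise_eq_of_mem _ _ _ h]; fun_prop
    · simp only [Finset.piecewise_eq_of_notMem _ _ _ h]; fun_prop
  conv_lhs => rw [← map_piecewise ν S, Measure.map_apply hm (hE.inter hF)]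
  rw [← Measure.prod_prod]
  congr 1
  ext z
  simp only [Set.mem_preimage, Set.mem_inter_iff, Set.mem_prod]
  refine and_congr (hES.mem_iff fun v hv => by simp [hv]) (hFT.mem_iff fun v hv => ?_)
  simp [Finset.disjoint_right.1 hST hv]

theorem measure_biInter_of_disjoint {J : Type} [DecidableEq J] (ν : Measure Ω)
    [IsProbabilityMeasure ν] (B : J → Finset ι) (E : J → Set (ι → Ω)) (s : Finset J)
    (hB : ∀ i ∈ s, ∀ j ∈ s, i ≠ j → Disjoint (B i) (B j)) (hE : ∀ i, MeasurableSet (E i))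
    (hEB : ∀ i, DeterminedBy (E i) (B i)) :
    Measure.pi (fun _ : ι => ν) (⋂ i ∈ s, E i) = ∏ i ∈ s, Measure.pi (fun _ : ι => ν) (E i) := by
  induction s using Finset.induction_on with
  | empty => simp
  | insert i s his ih =>
    rw [Finset.set_biInter_insert, Finset.prod_insert his,
      ← ih fun j hj l hl => hB j (Finset.mem_insert_of_mem hj) l (Finset.mem_insert_of_mem hl)]
    refine measure_inter_of_disjoint ν (S := B i) (T := s.biUnion B) ?_ (hE i)
      (s.measurableSet_biInter fun j _ => hE j) (hEB i) ?_
    · rw [Finset.disjoint_biUnion_right]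
      intro j hj
      exact hB i (Finset.mem_insert_self _ _) j (Finset.mem_insert_of_mem hj)
        (by rintro rfl; exact his hj)
    · intro ω ω' h hω
      simp only [Set.mem_iInter] at hω ⊢
      exact fun j hj => hEB j (fun v hv => h v (Finset.mem_biUnion.2 ⟨j, hj, hv⟩)) (hω j hj)

theorem measure_forall_mem (ν : Measure Ω) [IsProbabilityMeasure ν] (S : Finset ι)
    (s : ι → Set Ω) :
    Measure.pi (fun _ : ι => ν) {ω | ∀ v ∈ S, ω v ∈ s v} = ∏ v ∈ S, ν (s v) := by
  have : {ω : ι → Ω | ∀ v ∈ S, ω v ∈ s v} =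
      Set.univ.pi (S.piecewise s fun _ => Set.univ) := by
    ext ω
    simp only [Set.mem_ofPred_eq, Set.mem_univ_pi]
    refine forall_congr' fun v => ?_
    by_cases h : v ∈ S <;> simp [h]
  rw [this, Measure.pi_pi, ← Finset.prod_subset (Finset.subset_univ S)]
  · exact Finset.prod_congr rfl fun v hv => by simp [hv]
  · intro v _ hv; simp [hv]

/-- The event that `f` takes at the coordinate `u` a value at least as large as at all the
coordinates in `S`. -/
def leads (f : Ω → ℝ) (u : ι) (S : Finset ι) : Set (ι → Ω) :=
  {ω | ∀ v ∈ S, f (ω v) ≤ f (ω u)}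

omit [Fintype ι] [DecidableEq ι] in
theorem measurableSet_leads {f : Ω → ℝ} (hf : Measurable f) (u : ι) (S : Finset ι) :
    MeasurableSet (leads f u S) := by
  have : leads f u S = ⋂ v ∈ S, {ω : ι → Ω | f (ω v) ≤ f (ω u)} := by
    ext; simp [leads]
  rw [this]
  exact S.measurableSet_biInter fun v _ => measurableSet_le (by fun_prop) (by fun_prop)

omit [Fintype ι] [MeasurableSpace Ω] in
theorem determinedBy_leads (f : Ω → ℝ) (u : ι) (S : Finset ι) :
    DeterminedBy (leads f u S) (insert u S) := by
  intro ω ω' h hω v hv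
  rw [← h v (Finset.mem_insert_of_mem hv), ← h u (Finset.mem_insert_self _ _)]
  exact hω v hv

/-- Given the value `x` at `u`, the conditions at the coordinates of `S` are independent and equally
likely. -/
theorem measure_leads (ν : Measure Ω) [IsProbabilityMeasure ν] {f : Ω → ℝ} (hf : Measurable f)
    {u : ι} {S : Finset ι} (hu : u ∉ S) :
    Measure.pi (fun _ : ι => ν) (leads f u S) = ∫⁻ x, ν {z | f z ≤ f x} ^ S.card ∂ν := by
  rw [measure_eq_lintegral_update ν u (measurableSet_leads hf u S)]
  refine lintegral_congr fun x => ?_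
  rw [← Finset.prod_const, ← measure_forall_mem]
  congr 1
  ext ω
  simp only [leads, Set.mem_ofPred_eq, Function.update_self]
  refine forall₂_congr fun v hv => ?_
  rw [Function.update_of_ne (by rintro rfl; exact hu hv)]

/-- The events are dependent because `u` leads for `f` and is also a competitor of `w` for `g`.
Conditioning on the value `y` at `w`, then on `x` at `u`, leaves independent constraints and the
single coupling `g x ≤ g y`. -/
theorem measure_leads_inter_leads (ν : Measure Ω) [IsProbabilityMeasure ν] {f g : Ω → ℝ}
    (hf : Measurable f) (hg : Measurable g) {u w : ι} {S T : Finset ι} (huw : u ≠ w)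
    (hS : u ∉ S) (hT : u ∉ T) (hS' : w ∉ S) (hT' : w ∉ T) (hST : Disjoint S T) :
    Measure.pi (fun _ : ι => ν) (leads f u S ∩ leads g w (insert u T)) =
      ∫⁻ y, ν {z | g z ≤ g y} ^ T.card *
        ∫⁻ x in {x | g x ≤ g y}, ν {z | f z ≤ f x} ^ S.card ∂ν ∂ν := by
  have hm := (measurableSet_leads hf u S).inter (measurableSet_leads hg w (insert u T))
  rw [measure_eq_lintegral_update ν w hm]
  refine lintegral_congr fun y => ?_
  have hup : Measurable fun ω : ι → Ω => Function.update ω w y := by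
    rw [measurable_pi_iff]
    intro v
    by_cases h : v = w
    · subst h; simp
    · simp only [Function.update_of_ne h]; fun_prop
  change Measure.pi _ ((fun ω : ι → Ω => Function.update ω w y) ⁻¹' _) = _
  rw [measure_eq_lintegral_update ν u (hup hm),
    ← lintegral_indicator (measurableSet_le hg measurable_const),
    ← lintegral_const_mul' _ _ (by finiteness)]
  refine lintegral_congr fun x => ?_
  by_cases hxy : g x ≤ g y
  · rw [Set.indicator_of_mem (show x ∈ {a | g a ≤ g y} from hxy), mul_comm]
    have := measure_forall_mem ν (S ∪ T)
      fun v => if v ∈ S then {z | f z ≤ f x} else {z | g z ≤ g y}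
    rw [Finset.prod_union hST, Finset.prod_congr rfl (g := fun _ => ν {z | f z ≤ f x})
      (fun v hv => by simp [hv]), Finset.prod_congr (s₁ := T) rfl
      (g := fun _ => ν {z | g z ≤ g y})
      (fun v hv => by simp [Finset.disjoint_right.1 hST hv]), Finset.prod_const,
      Finset.prod_const] at this
    rw [← this]
    congr 1
    ext ω
    simp only [leads, Set.mem_ofPred_eq, Set.mem_inter_iff, Set.mem_preimage, Finset.mem_insert,
      forall_eq_or_imp, Function.update_self, Function.update_of_ne huw,
      hxy, true_and, Finset.mem_union]
    constructor
    · rintro ⟨h1, h2⟩ v hv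
      have hvu : v ≠ u := by rintro rfl; tauto
      have hvw : v ≠ w := by rintro rfl; tauto
      by_cases h : v ∈ S
      · simpa [h, hvu, hvw] using h1 v h
      · simpa [h, hvu, hvw] using h2 v (hv.resolve_left h)
    · intro h
      refine ⟨fun v hv => ?_, fun v hv => ?_⟩
      · have hvu : v ≠ u := by rintro rfl; tauto
        have hvw : v ≠ w := by rintro rfl; tauto
        simpa [hv, hvu, hvw] using h v (.inl hv)
      · have hvu : v ≠ u := by rintro rfl; tauto
        have hvw : v ≠ w := by rintro rfl; tauto
        simpa [Finset.disjoint_right.1 hST hv, hvu, hvw] using h v (.inr hv)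
  -- Here `u` itself beats `w` for `g`, so the event is empty.
  · rw [Set.indicator_of_notMem (show x ∉ {a | g a ≤ g y} from hxy), mul_zero]
    convert measure_empty (μ := Measure.pi fun _ : ι => ν)
    ext ω
    simp only [leads, Set.mem_ofPred_eq, Set.mem_inter_iff, Set.mem_preimage, Finset.mem_insert,
      forall_eq_or_imp, Function.update_self, Function.update_of_ne huw,
      hxy, false_and, and_false, Set.mem_empty_iff_false]

end ProductMeasure

/-! ### Integrals against the uniform law. -/

theorem lintegral_unifMeasure_congr {F G : ℝ → ENNReal}
    (h : ∀ x ∈ Set.Icc (0 : ℝ) 1, F x = G x) :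
    ∫⁻ x, F x ∂unifMeasure = ∫⁻ x, G x ∂unifMeasure :=
  setLIntegral_congr_fun measurableSet_Icc h

theorem unifMeasure_Iic {s : ℝ} (hs : s ∈ Set.Icc (0 : ℝ) 1) :
    unifMeasure (Set.Iic s) = ENNReal.ofReal s := by
  have : Set.Iic s ∩ Set.Icc 0 1 = Set.Icc 0 s := by
    ext x
    simp only [Set.mem_inter_iff, Set.mem_Iic, Set.mem_Icc] at hs ⊢
    constructor
    · rintro ⟨h1, h2, h3⟩; exact ⟨h2, h1⟩
    · rintro ⟨h1, h2⟩; exact ⟨h2, h1, h2.trans hs.2⟩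
  rw [unifMeasure, Measure.restrict_apply measurableSet_Iic, this]
  simp

theorem setLIntegral_Iic_unifMeasure_pow (m : ℕ) {s : ℝ} (hs : s ∈ Set.Icc (0 : ℝ) 1) :
    ∫⁻ x in Set.Iic s, unifMeasure (Set.Iic x) ^ m ∂unifMeasure =
      ENNReal.ofReal (s ^ (m + 1) / (m + 1)) := by
  have hI : Set.Iic s ∩ Set.Icc 0 1 = Set.Icc 0 s := by
    ext x
    simp only [Set.mem_inter_iff, Set.mem_Iic, Set.mem_Icc] at hs ⊢
    constructor
    · rintro ⟨h1, h2, h3⟩; exact ⟨h2, h1⟩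
    · rintro ⟨h1, h2⟩; exact ⟨h2, h1, h2.trans hs.2⟩
  have h1 : ∫⁻ x in Set.Iic s, unifMeasure (Set.Iic x) ^ m ∂unifMeasure =
      ∫⁻ x in Set.Icc 0 s, unifMeasure (Set.Iic x) ^ m := by
    rw [← hI, ← Measure.restrict_restrict measurableSet_Iic, ← unifMeasure]
  have h2 : ∫⁻ x in Set.Icc 0 s, unifMeasure (Set.Iic x) ^ m =
      ∫⁻ x in Set.Icc 0 s, ENNReal.ofReal (x ^ m) := by
    refine setLIntegral_congr_fun measurableSet_Icc fun x hx => ?_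
    rw [unifMeasure_Iic ⟨hx.1, hx.2.trans hs.2⟩, ENNReal.ofReal_pow hx.1]
  rw [h1, h2, ← ofReal_integral_eq_lintegral_ofReal]
  · rw [integral_Icc_eq_integral_Ioc, ← intervalIntegral.integral_of_le hs.1, integral_pow]
    simp
  · exact (continuous_pow m).integrableOn_Icc
  · filter_upwards [self_mem_ae_restrict measurableSet_Icc] with x hx
    exact pow_nonneg hx.1 m

theorem unifMeasure_Iic_one_compl : unifMeasure (Set.Iic (1 : ℝ))ᶜ = 0 := by
  have := isProbabilityMeasure_unifMeasure
  rw [prob_compl_eq_zero_iff measurableSet_Iic, unifMeasure_Iic (by simp), ENNReal.ofReal_one]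

theorem lintegral_unifMeasure_pow (m : ℕ) :
    ∫⁻ x, unifMeasure (Set.Iic x) ^ m ∂unifMeasure = ENNReal.ofReal (1 / (m + 1)) := by
  have h := setLIntegral_Iic_unifMeasure_pow m (s := 1) (by simp)
  rw [one_pow] at h
  rw [← h, Measure.restrict_eq_self_of_ae_mem]
  exact mem_ae_iff.2 unifMeasure_Iic_one_compl

theorem lintegral_unifMeasure_ofReal_pow (m : ℕ) :
    ∫⁻ x, ENNReal.ofReal (x ^ m) ∂unifMeasure = ENNReal.ofReal (1 / (m + 1)) := by
  rw [← lintegral_unifMeasure_pow]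
  refine lintegral_unifMeasure_congr fun x hx => ?_
  rw [unifMeasure_Iic hx, ENNReal.ofReal_pow hx.1]

/-! ### The joint law of the two payoffs at one profile. -/

/-- The law of the payoffs and the coin at a single action profile. -/
noncomputable def cellMeasure (p : ℝ) : Measure (ℝ × ℝ × Bool) :=
  unifMeasure.prod (unifMeasure.prod (coinMeasure p))

/-- The payoff of player A read off from the data of an action profile. -/
def cellA (z : ℝ × ℝ × Bool) : ℝ := z.1

/-- The payoff of player B read off from the data of an action profile. -/
def cellB (z : ℝ × ℝ × Bool) : ℝ := if z.2.2 then z.1 else z.2.1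

theorem measurable_cellA : Measurable cellA := measurable_fst

theorem measurable_cellB : Measurable cellB :=
  Measurable.ite (measurable_snd.comp measurable_snd (measurableSet_singleton true))
    measurable_fst (measurable_fst.comp measurable_snd)

theorem isProbabilityMeasure_cellMeasure {p : ℝ} (h0 : 0 ≤ p) (h1 : p ≤ 1) :
    IsProbabilityMeasure (cellMeasure p) := by
  have := isProbabilityMeasure_unifMeasure
  have := isProbabilityMeasure_coinMeasure h0 h1
  unfold cellMeasure
  infer_instance

theorem lintegral_cellMeasure {p : ℝ} (h0 : 0 ≤ p) (h1 : p ≤ 1) {F : ℝ × ℝ × Bool → ENNReal}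
    (hF : Measurable F) :
    ∫⁻ z, F z ∂cellMeasure p =
      ENNReal.ofReal p * ∫⁻ x, ∫⁻ v, F (x, v, true) ∂unifMeasure ∂unifMeasure +
      ENNReal.ofReal (1 - p) * ∫⁻ x, ∫⁻ v, F (x, v, false) ∂unifMeasure ∂unifMeasure := by
  have := isProbabilityMeasure_unifMeasure
  have := isProbabilityMeasure_coinMeasure h0 h1
  have key : ∀ x, ∫⁻ y, F (x, y) ∂(unifMeasure.prod (coinMeasure p)) =
      ENNReal.ofReal p * ∫⁻ v, F (x, v, true) ∂unifMeasure +
      ENNReal.ofReal (1 - p) * ∫⁻ v, F (x, v, false) ∂unifMeasure := by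
    intro x
    rw [lintegral_prod _ (by fun_prop)]
    simp only [coinMeasure, lintegral_add_measure, lintegral_smul_measure, lintegral_dirac,
      smul_eq_mul]
    rw [lintegral_add_left (by fun_prop), lintegral_const_mul _ (by fun_prop),
      lintegral_const_mul _ (by fun_prop)]
  rw [cellMeasure, lintegral_prod _ hF.aemeasurable]
  simp only [key]
  have m1 : Measurable fun x => ∫⁻ v, F (x, v, true) ∂unifMeasure :=
    Measurable.lintegral_prod_right' (f := fun q : ℝ × ℝ => F (q.1, q.2, true)) (by fun_prop)
  have m2 : Measurable fun x => ∫⁻ v, F (x, v, false) ∂unifMeasure :=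
    Measurable.lintegral_prod_right' (f := fun q : ℝ × ℝ => F (q.1, q.2, false)) (by fun_prop)
  rw [lintegral_add_left (by fun_prop), lintegral_const_mul _ (by fun_prop),
    lintegral_const_mul _ (by fun_prop)]

theorem ofReal_add_ofReal_one_sub {p : ℝ} (h0 : 0 ≤ p) (h1 : p ≤ 1) :
    ENNReal.ofReal p + ENNReal.ofReal (1 - p) = 1 := by
  rw [← ENNReal.ofReal_add h0 (sub_nonneg.2 h1)]; simp

theorem lintegral_comp_cellA {p : ℝ} (h0 : 0 ≤ p) (h1 : p ≤ 1) {F : ℝ → ENNReal}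
    (hF : Measurable F) : ∫⁻ z, F (cellA z) ∂cellMeasure p = ∫⁻ x, F x ∂unifMeasure := by
  have := isProbabilityMeasure_unifMeasure
  have hm : Measurable fun z => F (cellA z) := hF.comp measurable_cellA
  rw [lintegral_cellMeasure h0 h1 hm]
  simp [cellA, ← add_mul, ofReal_add_ofReal_one_sub h0 h1]

theorem lintegral_comp_cellB {p : ℝ} (h0 : 0 ≤ p) (h1 : p ≤ 1) {F : ℝ → ENNReal}
    (hF : Measurable F) : ∫⁻ z, F (cellB z) ∂cellMeasure p = ∫⁻ x, F x ∂unifMeasure := by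
  have := isProbabilityMeasure_unifMeasure
  have hm : Measurable fun z => F (cellB z) := hF.comp measurable_cellB
  rw [lintegral_cellMeasure h0 h1 hm]
  simp [cellB, ← add_mul, ofReal_add_ofReal_one_sub h0 h1]

/-- The two payoffs at an action profile, in either order: both are uniform, and their joint law is
the mixture of the diagonal and the product law. -/
structure IsCorrelatedPair (p : ℝ) (f g : ℝ × ℝ × Bool → ℝ) : Prop where
  measurable_fst : Measurable f
  measurable_snd : Measurable g
  lintegral_fst : ∀ F : ℝ → ENNReal, Measurable F →
    ∫⁻ z, F (f z) ∂cellMeasure p = ∫⁻ x, F x ∂unifMeasure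
  lintegral_snd : ∀ F : ℝ → ENNReal, Measurable F →
    ∫⁻ z, F (g z) ∂cellMeasure p = ∫⁻ x, F x ∂unifMeasure
  setLIntegral : ∀ F : ℝ → ENNReal, Measurable F → ∀ s : ℝ,
    ∫⁻ z in {z | g z ≤ s}, F (f z) ∂cellMeasure p =
      ENNReal.ofReal p * ∫⁻ x in Set.Iic s, F x ∂unifMeasure +
      ENNReal.ofReal (1 - p) * (unifMeasure (Set.Iic s) * ∫⁻ x, F x ∂unifMeasure)

theorem isCorrelatedPair_cellA_cellB {p : ℝ} (h0 : 0 ≤ p) (h1 : p ≤ 1) :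
    IsCorrelatedPair p cellA cellB where
  measurable_fst := measurable_cellA
  measurable_snd := measurable_cellB
  lintegral_fst F hF := lintegral_comp_cellA h0 h1 hF
  lintegral_snd F hF := lintegral_comp_cellB h0 h1 hF
  setLIntegral F hF s := by
    have := isProbabilityMeasure_unifMeasure
    have hs : MeasurableSet {z | cellB z ≤ s} := measurableSet_le measurable_cellB measurable_const
    have hm : Measurable fun z => F (cellA z) := hF.comp measurable_cellA
    rw [← lintegral_indicator hs, lintegral_cellMeasure h0 h1 (hm.indicator hs)]
    congr 2
    · rw [← lintegral_indicator measurableSet_Iic]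
      simp [Set.indicator, cellA, cellB]
    · rw [← lintegral_const_mul _ hF]
      refine lintegral_congr fun x => ?_
      rw [mul_comm, ← lintegral_indicator_const measurableSet_Iic]
      simp [Set.indicator, cellA, cellB]

theorem isCorrelatedPair_cellB_cellA {p : ℝ} (h0 : 0 ≤ p) (h1 : p ≤ 1) :
    IsCorrelatedPair p cellB cellA where
  measurable_fst := measurable_cellB
  measurable_snd := measurable_cellA
  lintegral_fst F hF := lintegral_comp_cellB h0 h1 hF
  lintegral_snd F hF := lintegral_comp_cellA h0 h1 hF
  setLIntegral F hF s := by
    have := isProbabilityMeasure_unifMeasure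
    have hs : MeasurableSet {z | cellA z ≤ s} := measurableSet_le measurable_cellA measurable_const
    have hm : Measurable fun z => F (cellB z) := hF.comp measurable_cellB
    rw [← lintegral_indicator hs, lintegral_cellMeasure h0 h1 (hm.indicator hs)]
    congr 2
    · rw [← lintegral_indicator measurableSet_Iic]
      simp [Set.indicator, cellA, cellB]
    · rw [mul_comm, ← lintegral_indicator_const measurableSet_Iic]
      refine lintegral_congr fun x => ?_
      by_cases hx : x ≤ s <;> simp [Set.indicator, cellA, cellB, hx]

namespace IsCorrelatedPair

variable {p : ℝ} {f g : ℝ × ℝ × Bool → ℝ}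

theorem measure_fst_le (h : IsCorrelatedPair p f g) (s : ℝ) :
    cellMeasure p {z | f z ≤ s} = unifMeasure (Set.Iic s) := by
  have := h.lintegral_fst (Set.indicator (Set.Iic s) 1)
    (measurable_one.indicator measurableSet_Iic)
  rw [lintegral_indicator_one measurableSet_Iic] at this
  rw [← this, ← lintegral_indicator_one (measurableSet_le h.measurable_fst measurable_const)]
  rfl

theorem measure_snd_le (h : IsCorrelatedPair p f g) (s : ℝ) :
    cellMeasure p {z | g z ≤ s} = unifMeasure (Set.Iic s) := by
  have := h.lintegral_snd (Set.indicator (Set.Iic s) 1)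
    (measurable_one.indicator measurableSet_Iic)
  rw [lintegral_indicator_one measurableSet_Iic] at this
  rw [← this, ← lintegral_indicator_one (measurableSet_le h.measurable_snd measurable_const)]
  rfl

theorem measurable_unifMeasure_Iic : Measurable fun x : ℝ => unifMeasure (Set.Iic x) :=
  Monotone.measurable fun _ _ hxy => measure_mono (Set.Iic_subset_Iic.2 hxy)

variable {ι : Type} [Fintype ι] [DecidableEq ι]

theorem measure_leads_fst (h : IsCorrelatedPair p f g) (h0 : 0 ≤ p) (h1 : p ≤ 1) {u : ι}
    {S : Finset ι} (hu : u ∉ S) :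
    Measure.pi (fun _ : ι => cellMeasure p) (ProductMeasure.leads f u S) =
      ENNReal.ofReal (1 / (S.card + 1)) := by
  have := isProbabilityMeasure_cellMeasure h0 h1
  rw [ProductMeasure.measure_leads _ h.measurable_fst hu]
  simp only [h.measure_fst_le]
  rw [h.lintegral_fst _ (measurable_unifMeasure_Iic.pow_const _), lintegral_unifMeasure_pow]

/-- With `m` and `n` the sizes of `S` and `T`, equal payoffs at `u` contribute `∫ y ^ n * y ^ (m +
1) / (m + 1)` over `[0, 1]`, and independent ones `∫ y ^ n * y / (m + 1)`. The larger denominator in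
the `p` term is the whole effect of the correlation. -/
theorem measure_leads_inter_leads (h : IsCorrelatedPair p f g) (h0 : 0 ≤ p) (h1 : p ≤ 1)
    {u w : ι} {S T : Finset ι} (huw : u ≠ w) (hS : u ∉ S) (hT : u ∉ T) (hS' : w ∉ S)
    (hT' : w ∉ T) (hST : Disjoint S T) :
    Measure.pi (fun _ : ι => cellMeasure p)
        (ProductMeasure.leads f u S ∩ ProductMeasure.leads g w (insert u T)) =
      ENNReal.ofReal (1 / (S.card + 1) *
        (p / (S.card + T.card + 2) + (1 - p) / (T.card + 2))) := by
  have := isProbabilityMeasure_cellMeasure h0 h1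
  rw [ProductMeasure.measure_leads_inter_leads _ h.measurable_fst h.measurable_snd huw hS hT hS'
    hT' hST]
  have hm := fun k => measurable_unifMeasure_Iic.pow_const k
  simp only [h.measure_fst_le, h.measure_snd_le]
  simp only [h.setLIntegral _ (hm _)]
  generalize S.card = m
  generalize T.card = n
  have e : ∀ s ∈ Set.Icc (0 : ℝ) 1, unifMeasure (Set.Iic s) ^ n *
      (ENNReal.ofReal p * ∫⁻ x in Set.Iic s, unifMeasure (Set.Iic x) ^ m ∂unifMeasure +
      ENNReal.ofReal (1 - p) * (unifMeasure (Set.Iic s) *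
        ∫⁻ x, unifMeasure (Set.Iic x) ^ m ∂unifMeasure)) =
      ENNReal.ofReal (p / (m + 1)) * ENNReal.ofReal (s ^ (m + n + 1)) +
        ENNReal.ofReal ((1 - p) / (m + 1)) * ENNReal.ofReal (s ^ (n + 1)) := by
    intro s hs
    have hs0 := hs.1
    have hp : 0 ≤ 1 - p := sub_nonneg.2 h1
    rw [setLIntegral_Iic_unifMeasure_pow m hs, lintegral_unifMeasure_pow, unifMeasure_Iic hs,
      ← ENNReal.ofReal_pow hs0, ← ENNReal.ofReal_mul hs0, ← ENNReal.ofReal_mul h0,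
      ← ENNReal.ofReal_mul hp, ← ENNReal.ofReal_add (by positivity) (by positivity),
      ← ENNReal.ofReal_mul (by positivity), ← ENNReal.ofReal_mul (by positivity),
      ← ENNReal.ofReal_mul (by positivity), ← ENNReal.ofReal_add (by positivity) (by positivity)]
    congr 1
    field_simp
    ring
  have hp : 0 ≤ 1 - p := sub_nonneg.2 h1
  have hmm : Measurable fun s => unifMeasure (Set.Iic s) ^ n *
      (ENNReal.ofReal p * ∫⁻ x in Set.Iic s, unifMeasure (Set.Iic x) ^ m ∂unifMeasure +
      ENNReal.ofReal (1 - p) * (unifMeasure (Set.Iic s) *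
        ∫⁻ x, unifMeasure (Set.Iic x) ^ m ∂unifMeasure)) := by
    have h2 : Measurable fun s : ℝ =>
        ∫⁻ x in Set.Iic s, unifMeasure (Set.Iic x) ^ m ∂unifMeasure :=
      Monotone.measurable fun _ _ hxy => lintegral_mono_set (Set.Iic_subset_Iic.2 hxy)
    have h3 := measurable_unifMeasure_Iic
    fun_prop
  rw [h.lintegral_snd _ hmm, lintegral_unifMeasure_congr e, lintegral_add_left (by fun_prop),
    lintegral_const_mul _ (by fun_prop), lintegral_const_mul _ (by fun_prop),
    lintegral_unifMeasure_ofReal_pow, lintegral_unifMeasure_ofReal_pow,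
    ← ENNReal.ofReal_mul (by positivity), ← ENNReal.ofReal_mul (by positivity),
    ← ENNReal.ofReal_add (by positivity) (by positivity)]
  congr 1
  push_cast
  field_simp
  ring

end IsCorrelatedPair

/-! ### Probability that a prescribed path follows best responses. -/

namespace IsCorrelatedPair

open ProductMeasure

variable {p : ℝ} {f g : ℝ × ℝ × Bool → ℝ} {α β ι J J' : Type} [Fintype ι] [DecidableEq ι]
  [Fintype J] [DecidableEq J] [Fintype J'] [DecidableEq J']

/-- Payoffs are arranged in a grid by `c`. In the columns `b i` the maximum of `f` is at `a' i`, and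
in the rows `a i` the maximum of `g` is at `b' i`. Comparisons with rows in `R` and columns in `S`
alone involve disjoint sets of cells, hence are independent. -/
theorem measureReal_lines_le (hf : IsCorrelatedPair p f g) (hg : IsCorrelatedPair p g f)
    (h0 : 0 ≤ p) (h1 : p ≤ 1) {c : α → β → ι} (hc : Function.Injective2 c)
    {b : J → β} (hb : b.Injective) (a' : J → α) {a : J' → α} (ha : a.Injective) (b' : J' → β)
    (R : Finset α) (S : Finset β) (haR : ∀ i, a i ∉ R) (haR' : ∀ i, a' i ∉ R)
    (hbS : ∀ i, b i ∉ S) (hbS' : ∀ i, b' i ∉ S) (hne : ∀ i j, a' i = a j → b i ≠ b' j) :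
    (Measure.pi fun _ : ι => cellMeasure p).real
      {ω | (∀ i x, f (ω (c x (b i))) ≤ f (ω (c (a' i) (b i)))) ∧
        ∀ i y, g (ω (c (a i) y)) ≤ g (ω (c (a i) (b' i)))} ≤
      (1 / (R.card + 1)) ^ Fintype.card J * (1 / (S.card + 1)) ^ Fintype.card J' := by
  classical
  have := isProbabilityMeasure_cellMeasure h0 h1
  -- Each block has one marked cell and otherwise only cells in rows of `R` or columns of `S`. A
  -- column block and a row block could meet only in a common marked cell, which `hne` forbids. Each
  -- cell is thus used for one payoff only, and the correlation plays no role.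
  let B : J ⊕ J' → Finset ι := Sum.elim
    (fun i => insert (c (a' i) (b i)) (R.image fun x => c x (b i)))
    (fun i => insert (c (a i) (b' i)) (S.image fun y => c (a i) y))
  let E : J ⊕ J' → Set (ι → ℝ × ℝ × Bool) := Sum.elim
    (fun i => leads f (c (a' i) (b i)) (R.image fun x => c x (b i)))
    (fun i => leads g (c (a i) (b' i)) (S.image fun y => c (a i) y))
  have hB : ∀ i ∈ Finset.univ, ∀ j ∈ Finset.univ, i ≠ j → Disjoint (B i) (B j) := by
    rintro (i | i) - (j | j) - hij <;>
      simp only [B, Sum.elim_inl, Sum.elim_inr, Finset.disjoint_left, Finset.mem_insert,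
        Finset.mem_image]
    · have : b i ≠ b j := fun h => hij (by rw [hb h])
      rintro v (rfl | ⟨x, hx, rfl⟩) (h | ⟨y, hy, h⟩) <;> have h := hc h <;> tauto
    · rintro v (rfl | ⟨x, hx, rfl⟩) (h | ⟨y, hy, h⟩) <;> have h := hc h
      · exact hne i j h.1 h.2
      · exact hbS i (h.2 ▸ hy)
      · exact haR j (h.1 ▸ hx)
      · exact haR j (h.1 ▸ hx)
    · rintro v (rfl | ⟨x, hx, rfl⟩) (h | ⟨y, hy, h⟩) <;> have h := hc h
      · exact hne j i h.1.symm h.2.symm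
      · exact haR i (h.1 ▸ hy)
      · exact hbS j (h.2 ▸ hx)
      · exact hbS j (h.2 ▸ hx)
    · have : a i ≠ a j := fun h => hij (by rw [ha h])
      rintro v (rfl | ⟨x, hx, rfl⟩) (h | ⟨y, hy, h⟩) <;> have h := hc h <;> tauto
  have hE : ∀ i, MeasurableSet (E i) := by
    rintro (i | i)
    · exact measurableSet_leads hf.measurable_fst _ _
    · exact measurableSet_leads hg.measurable_fst _ _
  have hEB : ∀ i, DeterminedBy (E i) (B i) := by
    rintro (i | i)
    · exact determinedBy_leads _ _ _
    · exact determinedBy_leads _ _ _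
  have key := measure_biInter_of_disjoint (cellMeasure p) B E Finset.univ hB hE hEB
  have hl : ∀ i, Measure.pi (fun _ : ι => cellMeasure p) (E (.inl i)) =
      ENNReal.ofReal (1 / (R.card + 1)) := by
    intro i
    rw [← Finset.card_image_of_injective R (hc.left (b i))]
    refine hf.measure_leads_fst h0 h1 ?_
    simp only [Finset.mem_image, not_exists, not_and]
    intro x hx h
    exact haR' i ((hc h).1 ▸ hx)
  have hr : ∀ i, Measure.pi (fun _ : ι => cellMeasure p) (E (.inr i)) =
      ENNReal.ofReal (1 / (S.card + 1)) := by
    intro i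
    rw [← Finset.card_image_of_injective S (hc.right (a i))]
    refine hg.measure_leads_fst h0 h1 ?_
    simp only [Finset.mem_image, not_exists, not_and]
    intro x hx h
    exact hbS' i ((hc h).2 ▸ hx)
  rw [Fintype.prod_sum_type] at key
  simp only [hl, hr, Finset.prod_const, Finset.card_univ] at key
  refine (measureReal_mono (s₂ := ⋂ i ∈ Finset.univ, E i) ?_).trans ?_
  · rintro ω ⟨h1, h2⟩
    simp only [Set.mem_iInter]
    rintro (i | i) -
    · intro v hv
      obtain ⟨x, -, rfl⟩ := Finset.mem_image.1 hv
      exact h1 i x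
    · intro v hv
      obtain ⟨x, -, rfl⟩ := Finset.mem_image.1 hv
      exact h2 i x
  · rw [measureReal_def, key, ENNReal.toReal_mul, ENNReal.toReal_pow, ENNReal.toReal_pow,
      ENNReal.toReal_ofReal (by positivity), ENNReal.toReal_ofReal (by positivity)]

/-- In the columns `b i` the maximum of `f` is at `a i`, and in the row `a i` the maximum of `g` is
at `b' i`. Only comparisons with rows in `R`, with columns in `S`, and of `(a i, b i)` with
`(a i, b' i)` are used. -/
theorem measureReal_corners_le (hf : IsCorrelatedPair p f g)
    (h0 : 0 ≤ p) (h1 : p ≤ 1) {c : α → β → ι} (hc : Function.Injective2 c)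
    {b : J → β} (hb : b.Injective) {a : J → α} (ha : a.Injective) (b' : J → β)
    (R : Finset α) (S : Finset β) (haR : ∀ i, a i ∉ R)
    (hbS : ∀ i, b i ∉ S) (hbS' : ∀ i, b' i ∉ S) (hne : ∀ i, b i ≠ b' i) :
    (Measure.pi fun _ : ι => cellMeasure p).real
      {ω | (∀ i x, f (ω (c x (b i))) ≤ f (ω (c (a i) (b i)))) ∧
        ∀ i y, g (ω (c (a i) y)) ≤ g (ω (c (a i) (b' i)))} ≤
      (1 / (R.card + 1) * (p / (R.card + S.card + 2) + (1 - p) / (S.card + 2))) ^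
        Fintype.card J := by
  classical
  have := isProbabilityMeasure_cellMeasure h0 h1
  -- The cell `(a i, b i)` is used for both payoffs, so its column and row must share a block.
  -- Distinct blocks are disjoint because `a` and `b` are injective and avoid `R` and `S`.
  let B : J → Finset ι := fun i =>
    insert (c (a i) (b i)) (R.image fun x => c x (b i)) ∪
      insert (c (a i) (b' i)) (insert (c (a i) (b i)) (S.image fun y => c (a i) y))
  let E : J → Set (ι → ℝ × ℝ × Bool) := fun i =>
    leads f (c (a i) (b i)) (R.image fun x => c x (b i)) ∩
      leads g (c (a i) (b' i)) (insert (c (a i) (b i)) (S.image fun y => c (a i) y))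
  have hB : ∀ i ∈ Finset.univ, ∀ j ∈ Finset.univ, i ≠ j → Disjoint (B i) (B j) := by
    intro i _ j _ hij
    have h1 : b i ≠ b j := fun h => hij (hb h)
    have h2 : a i ≠ a j := fun h => hij (ha h)
    have h3 := haR i
    have h4 := haR j
    have h5 := hbS i
    simp only [B, Finset.disjoint_left, Finset.mem_union, Finset.mem_insert, Finset.mem_image]
    rintro v ((rfl | ⟨x, hx, rfl⟩) | (rfl | rfl | ⟨x, hx, rfl⟩))
      ((h | ⟨y, hy, h⟩) | (h | h | ⟨y, hy, h⟩)) <;> obtain ⟨e1, e2⟩ := hc h <;>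
      first
        | exact h2 e1
        | exact h1 e2
        | exact h2 e1.symm
        | exact h1 e2.symm
        | (rw [e1] at hx; exact h4 hx)
        | (rw [e1] at hy; exact h3 hy)
        | (rw [e2] at hy; exact h5 hy)
  have hE : ∀ i, MeasurableSet (E i) := fun i =>
    (measurableSet_leads hf.measurable_fst _ _).inter (measurableSet_leads hf.measurable_snd _ _)
  have hEB : ∀ i, DeterminedBy (E i) (B i) := fun i ω ω' h hω =>
    ⟨determinedBy_leads _ _ _ (fun v hv => h v (Finset.mem_union_left _ hv)) hω.1,
      determinedBy_leads _ _ _ (fun v hv => h v (Finset.mem_union_right _ hv)) hω.2⟩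
  have key := measure_biInter_of_disjoint (cellMeasure p) B E Finset.univ hB hE hEB
  have hl : ∀ i, Measure.pi (fun _ : ι => cellMeasure p) (E i) =
      ENNReal.ofReal (1 / (R.card + 1) *
        (p / (R.card + S.card + 2) + (1 - p) / (S.card + 2))) := by
    intro i
    conv_rhs => rw [← Finset.card_image_of_injective R (hc.left (b i)),
      ← Finset.card_image_of_injective S (hc.right (a i))]
    refine hf.measure_leads_inter_leads h0 h1 (fun h => hne i (hc h).2) ?_ ?_ ?_ ?_ ?_
    · simp only [Finset.mem_image, not_exists, not_and]
      intro x hx h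
      exact haR i ((hc h).1 ▸ hx)
    · simp only [Finset.mem_image, not_exists, not_and]
      intro x hx h
      exact hbS i ((hc h).2 ▸ hx)
    · simp only [Finset.mem_image, not_exists, not_and]
      intro x hx h
      exact haR i ((hc h).1 ▸ hx)
    · simp only [Finset.mem_image, not_exists, not_and]
      intro x hx h
      exact hbS' i ((hc h).2 ▸ hx)
    · simp only [Finset.disjoint_left, Finset.mem_image]
      rintro v ⟨x, hx, rfl⟩ ⟨y, hy, h⟩
      exact haR i ((hc h).1 ▸ hx)
  simp only [hl, Finset.prod_const, Finset.card_univ] at key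
  refine (measureReal_mono (s₂ := ⋂ i ∈ Finset.univ, E i) ?_).trans ?_
  · rintro ω ⟨h1, h2⟩
    simp only [Set.mem_iInter]
    intro i _
    refine ⟨fun v hv => ?_, fun v hv => ?_⟩
    · obtain ⟨x, -, rfl⟩ := Finset.mem_image.1 hv
      exact h1 i x
    · rcases Finset.mem_insert.1 hv with rfl | hv
      · exact h2 i _
      · obtain ⟨x, -, rfl⟩ := Finset.mem_image.1 hv
        exact h2 i x
  · have hp : 0 ≤ 1 - p := sub_nonneg.2 h1
    rw [measureReal_def, key, ENNReal.toReal_pow, ENNReal.toReal_ofReal (by positivity)]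

end IsCorrelatedPair

theorem measureReal_le_card_mul {X I : Type} [MeasurableSpace X] [Fintype I] (μ : Measure X)
    [IsFiniteMeasure μ] {s : Set X} {P : I → Set X} {q : ℝ} (hs : s ⊆ ⋃ i, P i)
    (hq : ∀ i, μ.real (P i) ≤ q) : μ.real s ≤ Fintype.card I * q := by
  refine (measureReal_mono hs).trans ((measureReal_iUnion_fintype_le P).trans ?_)
  refine (Finset.sum_le_sum fun i _ => hq i).trans ?_
  simp

theorem card_univ_sdiff_image {α : Type} [Fintype α] [DecidableEq α] {k : ℕ} {a : Fin k → α}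
    (ha : a.Injective) :
    ((Finset.univ \ Finset.univ.image a).card : ℝ) = Fintype.card α - k := by
  rw [Finset.cast_card_sdiff (Finset.subset_univ _), Finset.card_image_of_injective _ ha]
  simp

/-! ### Union bounds over paths. -/

namespace IsCorrelatedPair

variable {p : ℝ} {f g : ℝ × ℝ × Bool → ℝ} {α β ι : Type} [Fintype ι] [DecidableEq ι]
  [Fintype α] [Fintype β]

/-- The initial column is left free. This costs one factor `Fintype.card β`, but makes the bound
usable for a path cut out of a longer one, and so with the players exchanged. -/
theorem measureReal_path_le (hf : IsCorrelatedPair p f g)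
    (h0 : 0 ≤ p) (h1 : p ≤ 1) {c : α → β → ι} (hc : Function.Injective2 c) (k : ℕ)
    (hα : k ≤ Fintype.card α) (hβ : k + 1 ≤ Fintype.card β) :
    (Measure.pi fun _ : ι => cellMeasure p).real
      {ω | ∃ a : Fin k → α, ∃ b : Fin (k + 1) → β, a.Injective ∧ b.Injective ∧
        (∀ i x, f (ω (c x (b i.castSucc))) ≤ f (ω (c (a i) (b i.castSucc)))) ∧
        ∀ i y, g (ω (c (a i) y)) ≤ g (ω (c (a i) (b i.succ)))} ≤
      Fintype.card α ^ k * Fintype.card β ^ (k + 1) *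
        (1 / (Fintype.card α - k + 1) * (p / (Fintype.card α - k + (Fintype.card β - k) + 1) +
          (1 - p) / (Fintype.card β - k + 1))) ^ k := by
  classical
  have := isProbabilityMeasure_cellMeasure h0 h1
  have hα' : (k : ℝ) ≤ Fintype.card α := by exact_mod_cast hα
  have hβ' : (k : ℝ) + 1 ≤ Fintype.card β := by exact_mod_cast hβ
  have hp : 0 ≤ 1 - p := sub_nonneg.2 h1
  let P : (Fin k → α) × (Fin (k + 1) → β) → Set (ι → ℝ × ℝ × Bool) := fun z =>
    {ω | z.1.Injective ∧ z.2.Injective ∧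
      (∀ i x, f (ω (c x (z.2 i.castSucc))) ≤ f (ω (c (z.1 i) (z.2 i.castSucc)))) ∧
      ∀ i y, g (ω (c (z.1 i) y)) ≤ g (ω (c (z.1 i) (z.2 i.succ)))}
  refine (measureReal_le_card_mul _ (P := P)
    (q := (1 / (Fintype.card α - k + 1) * (p / (Fintype.card α - k + (Fintype.card β - k) + 1) +
          (1 - p) / (Fintype.card β - k + 1))) ^ k) ?_ ?_).trans (le_of_eq ?_)
  · rintro ω ⟨a, b, ha, hb, h⟩
    exact Set.mem_iUnion.2 ⟨(a, b), ha, hb, h⟩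
  · rintro ⟨a, b⟩
    by_cases hab : a.Injective ∧ b.Injective
    · obtain ⟨ha, hb⟩ := hab
      -- Comparisons are restricted to unvisited actions: `k` rows and `k + 1` columns are removed.
      have h := hf.measureReal_corners_le h0 h1 hc (b := fun i : Fin k => b i.castSucc)
        (hb.comp (Fin.castSucc_injective k)) ha (fun i => b i.succ)
        (Finset.univ \ Finset.univ.image a) (Finset.univ \ Finset.univ.image b)
        (by simp) (by simp) (by simp) (fun i h => by simpa [Fin.ext_iff] using hb h)
      rw [card_univ_sdiff_image ha, card_univ_sdiff_image hb, Fintype.card_fin] at h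
      push_cast at h
      refine (measureReal_mono ?_).trans (h.trans (le_of_eq ?_))
      · rintro ω ⟨-, -, h⟩
        exact h
      · ring_nf
    · have : P (a, b) = ∅ := by
        ext ω
        simp only [P, Set.mem_ofPred_eq, Set.mem_empty_iff_false, iff_false]
        tauto
      rw [this, measureReal_empty]
      have : (0 : ℝ) ≤ Fintype.card α - k := by linarith
      have : (0 : ℝ) ≤ Fintype.card β - k := by linarith
      positivity
  · simp

/-- With `b 0` fixed there are `j` free rows, `j` free columns and the index `l`, against `j + 1`
column conditions and `j` row conditions. The `Fin.snoc` encodes that the best response to the last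
column is the old row `a l`. -/
theorem measureReal_row_return_le (hf : IsCorrelatedPair p f g) (hg : IsCorrelatedPair p g f)
    (h0 : 0 ≤ p) (h1 : p ≤ 1) {c : α → β → ι} (hc : Function.Injective2 c) (y₀ : β) (j : ℕ)
    (hα : j ≤ Fintype.card α) (hβ : j ≤ Fintype.card β) :
    (Measure.pi fun _ : ι => cellMeasure p).real
      {ω | ∃ a : Fin j → α, ∃ b : Fin (j + 1) → β, ∃ l : Fin j, a.Injective ∧ b.Injective ∧
        b 0 = y₀ ∧ (l : ℕ) + 1 ≠ j ∧
        (∀ i x, f (ω (c x (b i))) ≤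
          f (ω (c (Fin.snoc (α := fun _ => α) a (a l) i) (b i)))) ∧
        ∀ i y, g (ω (c (a i) y)) ≤ g (ω (c (a i) (b i.succ)))} ≤
      Fintype.card α ^ j * Fintype.card β ^ j * j *
        ((1 / (Fintype.card α - j + 1)) ^ (j + 1) * (1 / (Fintype.card β - j)) ^ j) := by
  classical
  have := isProbabilityMeasure_cellMeasure h0 h1
  have hα' : (0 : ℝ) ≤ Fintype.card α - j := sub_nonneg.2 (by exact_mod_cast hα)
  have hβ' : (0 : ℝ) ≤ Fintype.card β - j := sub_nonneg.2 (by exact_mod_cast hβ)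
  let P : (Fin j → α) × (Fin j → β) × Fin j → Set (ι → ℝ × ℝ × Bool) := fun z =>
    let b : Fin (j + 1) → β := Fin.cons y₀ z.2.1
    {ω | z.1.Injective ∧ b.Injective ∧ (z.2.2 : ℕ) + 1 ≠ j ∧
      (∀ i x, f (ω (c x (b i))) ≤
        f (ω (c (Fin.snoc (α := fun _ => α) z.1 (z.1 z.2.2) i) (b i)))) ∧
      ∀ i y, g (ω (c (z.1 i) y)) ≤ g (ω (c (z.1 i) (b i.succ)))}
  refine (measureReal_le_card_mul _ (P := P)
    (q := (1 / (Fintype.card α - j + 1)) ^ (j + 1) * (1 / (Fintype.card β - j)) ^ j)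
    ?_ ?_).trans (le_of_eq ?_)
  · rintro ω ⟨a, b, l, ha, hb, rfl, h⟩
    refine Set.mem_iUnion.2 ⟨(a, Fin.tail b, l), ?_⟩
    simp only [P, Fin.cons_self_tail, Set.mem_ofPred_eq]
    exact ⟨ha, hb, h⟩
  · rintro ⟨a, b, l⟩
    by_cases hab : a.Injective ∧ (Fin.cons y₀ b : Fin (j + 1) → β).Injective ∧ (l : ℕ) + 1 ≠ j
    · obtain ⟨ha, hb, hl⟩ := hab
      have h := hf.measureReal_lines_le hg h0 h1 hc hb
        (Fin.snoc (α := fun _ => α) a (a l)) ha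
        (fun i => (Fin.cons y₀ b : Fin (j + 1) → β) i.succ)
        (Finset.univ \ Finset.univ.image a)
        (Finset.univ \ Finset.univ.image (Fin.cons y₀ b : Fin (j + 1) → β))
        (by simp)
        (fun i => by refine Fin.lastCases ?_ (fun i => ?_) i <;> simp)
        (by simp) (fun i => by simpa using ⟨i.succ, by simp⟩)
        -- The marked cells of columns and rows differ. For the last column, in row `a l`, this is
        -- exactly `l + 1 ≠ j`.
        (by
          intro i m
          refine Fin.lastCases ?_ (fun i => ?_) i
          · intro h1 h2
            simp only [Fin.snoc_last] at h1
            have h1 := ha h1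
            have h2 := hb h2
            simp only [Fin.ext_iff, Fin.val_last, Fin.val_succ] at h1 h2
            omega
          · intro h1 h2
            simp only [Fin.snoc_castSucc] at h1
            have h1 := ha h1
            have h2 := hb h2
            simp only [Fin.ext_iff, Fin.val_castSucc, Fin.val_succ] at h1 h2
            omega)
      rw [card_univ_sdiff_image ha, card_univ_sdiff_image hb, Fintype.card_fin,
        Fintype.card_fin] at h
      push_cast at h
      refine (measureReal_mono ?_).trans (h.trans (le_of_eq ?_))
      · rintro ω ⟨-, -, -, h⟩
        exact h
      · ring_nf
    · have : P (a, b, l) = ∅ := by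
        ext ω
        simp only [P, Set.mem_ofPred_eq, Set.mem_empty_iff_false, iff_false]
        tauto
      rw [this, measureReal_empty]
      positivity
  · simp only [Fintype.card_prod, Fintype.card_fun, Fintype.card_fin, Nat.cast_mul, Nat.cast_pow]
    ring

/-- Here the surplus condition is on a row: the best response to the last row is the old column `b
l.castSucc`. -/
theorem measureReal_column_return_le (hf : IsCorrelatedPair p f g) (hg : IsCorrelatedPair p g f)
    (h0 : 0 ≤ p) (h1 : p ≤ 1) {c : α → β → ι} (hc : Function.Injective2 c) (y₀ : β) (j : ℕ)
    (hα : j ≤ Fintype.card α) (hβ : j ≤ Fintype.card β) :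
    (Measure.pi fun _ : ι => cellMeasure p).real
      {ω | ∃ a : Fin (j + 1) → α, ∃ b : Fin (j + 1) → β, ∃ l : Fin j, a.Injective ∧
        b.Injective ∧ b 0 = y₀ ∧
        (∀ i x, f (ω (c x (b i))) ≤ f (ω (c (a i) (b i)))) ∧
        ∀ i y, g (ω (c (a i) y)) ≤
          g (ω (c (a i) (Fin.snoc (α := fun _ => β) (fun i : Fin j => b i.succ)
            (b l.castSucc) i)))} ≤
      Fintype.card α ^ (j + 1) * Fintype.card β ^ j * j *
        ((1 / (Fintype.card α - j)) ^ (j + 1) * (1 / (Fintype.card β - j)) ^ (j + 1)) := by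
  classical
  have := isProbabilityMeasure_cellMeasure h0 h1
  have hα' : (0 : ℝ) ≤ Fintype.card α - j := sub_nonneg.2 (by exact_mod_cast hα)
  have hβ' : (0 : ℝ) ≤ Fintype.card β - j := sub_nonneg.2 (by exact_mod_cast hβ)
  let P : (Fin (j + 1) → α) × (Fin j → β) × Fin j → Set (ι → ℝ × ℝ × Bool) := fun z =>
    let b : Fin (j + 1) → β := Fin.cons y₀ z.2.1
    {ω | z.1.Injective ∧ b.Injective ∧
      (∀ i x, f (ω (c x (b i))) ≤ f (ω (c (z.1 i) (b i)))) ∧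
      ∀ i y, g (ω (c (z.1 i) y)) ≤
          g (ω (c (z.1 i) (Fin.snoc (α := fun _ => β) (fun i : Fin j => b i.succ)
            (b z.2.2.castSucc) i)))}
  refine (measureReal_le_card_mul _ (P := P)
    (q := (1 / (Fintype.card α - j)) ^ (j + 1) * (1 / (Fintype.card β - j)) ^ (j + 1))
    ?_ ?_).trans (le_of_eq ?_)
  · rintro ω ⟨a, b, l, ha, hb, rfl, h⟩
    refine Set.mem_iUnion.2 ⟨(a, Fin.tail b, l), ?_⟩
    simp only [P, Fin.cons_self_tail, Set.mem_ofPred_eq]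
    exact ⟨ha, hb, h⟩
  · rintro ⟨a, b, l⟩
    by_cases hab : a.Injective ∧ (Fin.cons y₀ b : Fin (j + 1) → β).Injective
    · obtain ⟨ha, hb⟩ := hab
      have h := hf.measureReal_lines_le hg h0 h1 hc hb a ha
        (Fin.snoc (α := fun _ => β)
          (fun i : Fin j => (Fin.cons y₀ b : Fin (j + 1) → β) i.succ)
          ((Fin.cons y₀ b : Fin (j + 1) → β) l.castSucc))
        (Finset.univ \ Finset.univ.image a)
        (Finset.univ \ Finset.univ.image (Fin.cons y₀ b : Fin (j + 1) → β))
        (by simp) (by simp) (by simp)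
        (fun i => by
          refine Fin.lastCases ?_ (fun i => ?_) i
          · rw [Fin.snoc_last]; simp
          · rw [Fin.snoc_castSucc]; simpa using ⟨i.succ, by simp⟩)
        (by
          intro i m h1
          obtain rfl := ha h1
          refine Fin.lastCases ?_ (fun i => ?_) i
          · intro h2
            rw [Fin.snoc_last] at h2
            have h2 := hb h2
            simp only [Fin.ext_iff, Fin.val_last, Fin.val_castSucc] at h2
            omega
          · intro h2
            rw [Fin.snoc_castSucc] at h2
            have h2 := hb h2
            simp only [Fin.ext_iff, Fin.val_castSucc, Fin.val_succ] at h2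
            omega)
      rw [card_univ_sdiff_image ha, card_univ_sdiff_image hb, Fintype.card_fin] at h
      push_cast at h
      refine (measureReal_mono ?_).trans (h.trans (le_of_eq ?_))
      · rintro ω ⟨-, -, h⟩
        exact h
      · ring_nf
    · have : P (a, b, l) = ∅ := by
        ext ω
        simp only [P, Set.mem_ofPred_eq, Set.mem_empty_iff_false, iff_false]
        tauto
      rw [this, measureReal_empty]
      positivity
  · simp only [Fintype.card_prod, Fintype.card_fun, Fintype.card_fin, Nat.cast_mul, Nat.cast_pow]
    ring

end IsCorrelatedPair

/-! ### Best-response dynamics that never reaches an equilibrium. -/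

namespace BimatrixGame

variable {α β : Type} (G : BimatrixGame α β)

theorem stepA_snd (x : α × β) : (G.stepA x).2 = x.2 := by
  unfold stepA; split_ifs <;> rfl

theorem stepB_fst (x : α × β) : (G.stepB x).1 = x.1 := by
  unfold stepB; split_ifs <;> rfl

theorem stepA_fst_mem_argmaxA [Finite α] (x : α × β) : (G.stepA x).1 ∈ G.argmaxA x.2 := by
  have : Nonempty α := ⟨x.1⟩
  obtain ⟨a, ha⟩ := Finite.exists_max fun a => G.payA a x.2
  unfold stepA
  split_ifs with h
  · exact h.some_mem.1
  · by_contra hx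
    exact h ⟨a, ha, fun hax => hx (by rw [Set.mem_singleton_iff] at hax; rw [← hax]; exact ha)⟩

theorem stepB_snd_mem_argmaxB [Finite β] (x : α × β) : (G.stepB x).2 ∈ G.argmaxB x.1 := by
  have : Nonempty β := ⟨x.2⟩
  obtain ⟨b, hb⟩ := Finite.exists_max fun b => G.payB x.1 b
  unfold stepB
  split_ifs with h
  · exact h.some_mem.1
  · by_contra hx
    exact h ⟨b, hb, fun hbx => hx (by rw [Set.mem_singleton_iff] at hbx; rw [← hbx]; exact hb)⟩

theorem brd_notMem_pureNash {x₀ : α × β} (h : G.nashTime x₀ = ⊤) (t : ℕ) :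
    G.brd x₀ t ∉ G.pureNash := by
  intro ht
  simp only [nashTime, iInf_eq_top] at h
  exact ENat.natCast_ne_top t (h t ht)

/-- Take the row after each move of A and the column before it. A revision that leaves the action
unchanged would exhibit a profile of mutual best responses, that is, an equilibrium. -/
theorem exists_best_response_sequences [Finite α] [Finite β] {x₀ : α × β}
    (h : G.nashTime x₀ = ⊤) :
    ∃ (a : ℕ → α) (b : ℕ → β), b 0 = x₀.2 ∧ (∀ t, a t ∈ G.argmaxA (b t)) ∧
      (∀ t, b (t + 1) ∈ G.argmaxB (a t)) ∧ (∀ t, a t ≠ a (t + 1)) ∧ ∀ t, b t ≠ b (t + 1) := by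
  have hA : ∀ t, G.brd x₀ (2 * t + 1) = G.stepA (G.brd x₀ (2 * t)) := fun t => by
    simp [brd]
  have hB : ∀ t, G.brd x₀ (2 * (t + 1)) = G.stepB (G.brd x₀ (2 * t + 1)) := fun t => by
    rw [show 2 * (t + 1) = 2 * t + 1 + 1 by ring, brd, if_neg (by simp)]
  have h1 : ∀ t, (G.brd x₀ (2 * t + 1)).1 ∈ G.argmaxA (G.brd x₀ (2 * t)).2 := fun t => by
    rw [hA]; exact G.stepA_fst_mem_argmaxA _
  have h2 : ∀ t, (G.brd x₀ (2 * (t + 1))).2 ∈ G.argmaxB (G.brd x₀ (2 * t + 1)).1 := fun t => by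
    rw [hB]; exact G.stepB_snd_mem_argmaxB _
  have h3 : ∀ t, (G.brd x₀ (2 * t + 1)).2 = (G.brd x₀ (2 * t)).2 := fun t => by
    rw [hA, stepA_snd]
  have h4 : ∀ t, (G.brd x₀ (2 * (t + 1))).1 = (G.brd x₀ (2 * t + 1)).1 := fun t => by
    rw [hB, stepB_fst]
  refine ⟨fun t => (G.brd x₀ (2 * t + 1)).1, fun t => (G.brd x₀ (2 * t)).2, rfl, h1, h2,
    fun t e => ?_, fun t e => ?_⟩ <;> beta_reduce at e
  · refine G.brd_notMem_pureNash h (2 * (t + 1)) ⟨?_, ?_⟩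
    · rw [h4]
      have := h1 (t + 1)
      rw [← e] at this
      exact this
    · rw [h4]; exact h2 t
  · refine G.brd_notMem_pureNash h (2 * t + 1) ⟨?_, ?_⟩
    · rw [h3]; exact h1 t
    · rw [h3, e]; exact h2 t

end BimatrixGame

/-- Actions are revealed in the order `b 0, a 0, b 1, a 1, …`, and the first repetition is recorded.
Distinctness of consecutive terms excludes `l + 1 = j` for a row and `l = j` for a column. -/
theorem injOn_or_exists_return {α β : Type} {a : ℕ → α} {b : ℕ → β}
    (ha : ∀ t, a t ≠ a (t + 1)) (hb : ∀ t, b t ≠ b (t + 1)) (n : ℕ) :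
    (Set.InjOn a (Set.Iio n) ∧ Set.InjOn b (Set.Iio (n + 1))) ∨
      ∃ j < n, (Set.InjOn a (Set.Iio j) ∧ Set.InjOn b (Set.Iio (j + 1)) ∧
          ∃ l < j, l + 1 ≠ j ∧ a j = a l) ∨
        (Set.InjOn a (Set.Iio (j + 1)) ∧ Set.InjOn b (Set.Iio (j + 1)) ∧
          ∃ l < j, b (j + 1) = b l) := by
  have ext : ∀ {γ : Type} {s : ℕ → γ} {m : ℕ}, Set.InjOn s (Set.Iio m) →
      Set.InjOn s (Set.Iio (m + 1)) ∨ ∃ l < m, s m = s l := by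
    intro γ s m hs
    by_cases h : ∃ l < m, s m = s l
    · exact .inr h
    · refine .inl ?_
      rw [show Set.Iio (m + 1) = insert m (Set.Iio m) by ext; simp, Set.injOn_insert (by simp)]
      refine ⟨hs, ?_⟩
      rintro ⟨l, hl, e⟩
      exact h ⟨l, hl, e.symm⟩
  induction n with
  | zero =>
    refine .inl ⟨by intro x hx; simp at hx, ?_⟩
    intro x hx y hy _
    simp at hx hy
    omega
  | succ n ih =>
    rcases ih with ⟨h1, h2⟩ | ⟨j, hj, h⟩
    · rcases ext h1 with h1' | ⟨l, hl, e⟩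
      · rcases ext h2 with h2' | ⟨l, hl, e⟩
        · exact .inl ⟨h1', h2'⟩
        · refine .inr ⟨n, by simp, .inr ⟨h1', h2, l, ?_, e⟩⟩
          rcases (Nat.lt_succ_iff_lt_or_eq.1 hl) with h | rfl
          · exact h
          · exact absurd e.symm (hb _)
      · refine .inr ⟨n, by simp, .inl ⟨h1, h2, l, hl, ?_, e⟩⟩
        rintro rfl
        exact ha _ e.symm
    · exact .inr ⟨j, hj.trans (Nat.lt_succ_self n), h⟩

/-! ### Real estimates for the union bounds. -/

theorem div_sub_le_exp {x d n K : ℝ} (hK : 0 < K) (hd : d ≤ n) (hn : 2 * n ≤ K) (hx : K ≤ x)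
    (hn0 : 0 ≤ n) : x * (1 / (x - d)) ≤ Real.exp (2 * n / K) := by
  refine le_trans ?_ (Real.add_one_le_exp _)
  have : 0 < x - d := by linarith
  rw [mul_one_div, div_add_one hK.ne', div_le_div_iff₀ this hK]
  nlinarith

/-- The bound on the long paths. -/
theorem path_bound {A B p : ℝ} {k n : ℕ} (hk : k < n) (h0 : 0 ≤ p) (h1 : p ≤ 1) (hAB : B ≤ A)
    (hn : 2 * (n : ℝ) ≤ B) :
    A ^ k * B ^ (k + 1) * (1 / (A - k + 1) * (p / (A - k + (B - k) + 1) +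
      (1 - p) / (B - k + 1))) ^ k ≤
      Real.exp (4 * n ^ 2 / B) * (B * Real.exp (-(p * k / 3))) := by
  have hkn : (k : ℝ) + 1 ≤ n := by exact_mod_cast hk
  have hk0 : (0 : ℝ) ≤ k := k.cast_nonneg
  have hB : 0 < B := by linarith
  have hp : 0 ≤ 1 - p := sub_nonneg.2 h1
  have e1 : p / (A - k + (B - k) + 1) + (1 - p) / (B - k + 1) ≤
      1 / (B - k + 1) * Real.exp (-(p / 3)) := by
    -- This uses `B ≤ A` and `1 ≤ B - k`. The `3 / 2` turns the factor into `1 - p / 3`, since `2 /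
    -- 3 * p + (1 - p) = 1 - p / 3`.
    have a1 : p / (A - k + (B - k) + 1) ≤ p / (3 / 2 * (B - k + 1)) := by
      apply div_le_div_of_nonneg_left h0 <;> linarith
    have a2 : p / (3 / 2 * (B - k + 1)) + (1 - p) / (B - k + 1) =
        1 / (B - k + 1) * (-(p / 3) + 1) := by
      have : B - k + 1 ≠ 0 := by linarith
      field_simp
      ring
    have a3 : (0 : ℝ) ≤ 1 / (B - k + 1) := one_div_nonneg.2 (by linarith)
    have := mul_le_mul_of_nonneg_left (Real.add_one_le_exp (-(p / 3))) a3
    linarith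
  have e2 : A * (1 / (A - k + 1)) ≤ Real.exp (2 * n / B) := by
    have := div_sub_le_exp hB (x := A) (d := k - 1) (n := n) (by linarith) hn hAB (by linarith)
    rwa [← sub_add] at this
  have e3 : B * (1 / (B - k + 1)) ≤ Real.exp (2 * n / B) := by
    have := div_sub_le_exp hB (x := B) (d := k - 1) (n := n) (by linarith) hn le_rfl (by linarith)
    rwa [← sub_add] at this
  have d1 : 0 < A - k + 1 := by linarith
  have d2 : 0 < B - k + 1 := by linarith
  have d3 : 0 < A - k + (B - k) + 1 := by linarith
  have hA : 0 < A := by linarith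
  calc A ^ k * B ^ (k + 1) * (1 / (A - k + 1) * (p / (A - k + (B - k) + 1) +
      (1 - p) / (B - k + 1))) ^ k
      = B * ((A * (1 / (A - k + 1))) * (B * (p / (A - k + (B - k) + 1) +
          (1 - p) / (B - k + 1)))) ^ k := by rw [mul_pow, mul_pow, mul_pow, mul_pow]; ring
    _ ≤ B * (Real.exp (2 * n / B) * (Real.exp (2 * n / B) * Real.exp (-(p / 3)))) ^ k := by
        refine mul_le_mul_of_nonneg_left (pow_le_pow_left₀ (by positivity)
          (mul_le_mul e2 ?_ (by positivity) (Real.exp_pos _).le) k) hB.le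
        refine (mul_le_mul_of_nonneg_left e1 hB.le).trans ?_
        rw [← mul_assoc]
        exact mul_le_mul_of_nonneg_right e3 (Real.exp_pos _).le
    _ = B * (Real.exp (k * (4 * n / B)) * Real.exp (-(p * k / 3))) := by
        rw [← Real.exp_add, ← Real.exp_add, ← Real.exp_nat_mul, ← Real.exp_add]
        congr 2
        field_simp
        ring
    _ ≤ B * (Real.exp (4 * n ^ 2 / B) * Real.exp (-(p * k / 3))) := by
        gcongr
        rw [mul_div_assoc', div_le_div_iff_of_pos_right hB]
        nlinarith
    _ = _ := by ring

/-- Choices and conditions pair off into factors close to `1`; the surplus condition together with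
the choice of `l` leaves `j / (A - j + 1)`. -/
theorem row_return_bound {A B K : ℝ} {j n : ℕ} (hj : j < n) (hA : K ≤ A) (hB : K ≤ B)
    (hn : 2 * (n : ℝ) ≤ K) :
    A ^ j * B ^ j * j * ((1 / (A - j + 1)) ^ (j + 1) * (1 / (B - j)) ^ j) ≤
      Real.exp (4 * n ^ 2 / K) * (2 * n / K) := by
  have hjn : (j : ℝ) + 1 ≤ n := by exact_mod_cast hj
  have hj0 : (0 : ℝ) ≤ j := j.cast_nonneg
  have hK : 0 < K := by linarith
  have e2 : A * (1 / (A - j + 1)) ≤ Real.exp (2 * n / K) := by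
    have := div_sub_le_exp hK (x := A) (d := j - 1) (n := n) (by linarith) hn hA (by linarith)
    rwa [← sub_add] at this
  have e3 : B * (1 / (B - j)) ≤ Real.exp (2 * n / K) :=
    div_sub_le_exp hK (by linarith) hn hB (by linarith)
  have d1 : 0 < A - j + 1 := by linarith
  have d2 : 0 < B - j := by linarith
  have hA0 : 0 < A := by linarith
  have hB0 : 0 < B := by linarith
  have e4 : j * (1 / (A - j + 1)) ≤ 2 * n / K := by
    rw [mul_one_div, div_le_div_iff₀ d1 hK]
    nlinarith
  calc A ^ j * B ^ j * j * ((1 / (A - j + 1)) ^ (j + 1) * (1 / (B - j)) ^ j)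
      = ((A * (1 / (A - j + 1))) * (B * (1 / (B - j)))) ^ j * (j * (1 / (A - j + 1))) := by
        rw [mul_pow, mul_pow, mul_pow]; ring
    _ ≤ (Real.exp (2 * n / K) * Real.exp (2 * n / K)) ^ j * (2 * n / K) := by gcongr
    _ = Real.exp (j * (4 * n / K)) * (2 * n / K) := by
        rw [← Real.exp_add, ← Real.exp_nat_mul]
        congr 2
        ring
    _ ≤ _ := by
        gcongr
        rw [mul_div_assoc', div_le_div_iff_of_pos_right hK]
        nlinarith

theorem column_return_bound {A B K : ℝ} {j n : ℕ} (hj : j < n) (hA : K ≤ A) (hB : K ≤ B)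
    (hn : 2 * (n : ℝ) ≤ K) :
    A ^ (j + 1) * B ^ j * j * ((1 / (A - j)) ^ (j + 1) * (1 / (B - j)) ^ (j + 1)) ≤
      Real.exp (4 * n ^ 2 / K) * (2 * n / K) := by
  have hjn : (j : ℝ) + 1 ≤ n := by exact_mod_cast hj
  have hj0 : (0 : ℝ) ≤ j := j.cast_nonneg
  have hK : 0 < K := by linarith
  have e2 : A * (1 / (A - j)) ≤ Real.exp (2 * n / K) :=
    div_sub_le_exp hK (by linarith) hn hA (by linarith)
  have e3 : B * (1 / (B - j)) ≤ Real.exp (2 * n / K) :=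
    div_sub_le_exp hK (by linarith) hn hB (by linarith)
  have d1 : 0 < A - j := by linarith
  have d2 : 0 < B - j := by linarith
  have hA0 : 0 < A := by linarith
  have hB0 : 0 < B := by linarith
  have e4 : j * (1 / (B - j)) ≤ 2 * n / K := by
    rw [mul_one_div, div_le_div_iff₀ d2 hK]
    nlinarith
  calc A ^ (j + 1) * B ^ j * j * ((1 / (A - j)) ^ (j + 1) * (1 / (B - j)) ^ (j + 1))
      = (A * (1 / (A - j))) ^ (j + 1) * (B * (1 / (B - j))) ^ j * (j * (1 / (B - j))) := by
        rw [mul_pow, mul_pow]; ring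
    _ ≤ Real.exp (2 * n / K) ^ (j + 1) * Real.exp (2 * n / K) ^ j * (2 * n / K) := by gcongr
    _ = Real.exp ((2 * j + 1) * (2 * n / K)) * (2 * n / K) := by
        rw [← pow_add, ← Real.exp_nat_mul]
        congr 2
        push_cast
        ring
    _ ≤ _ := by
        gcongr
        rw [mul_div_assoc', div_le_div_iff_of_pos_right hK]
        nlinarith

/-! ### The bound for a fixed game size, and the limit. -/

theorem measureReal_nashTime_eq_top_le {α β : Type} [Fintype α] [Fintype β] {p : ℝ} (h0 : 0 ≤ p)
    (h1 : p ≤ 1) (x₀ : α × β) {k K : ℕ} (hK : K = min (Fintype.card α) (Fintype.card β))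
    (hk : 2 * (k + 1) ≤ K) :
    (gameMeasure α β p).real {ω | (randomGame ω).nashTime x₀ = ⊤} ≤
      Real.exp (4 * (k + 1) ^ 2 / K) * (4 * (k + 1) ^ 2 / K + K * Real.exp (-(p * k / 3))) := by
  classical
  have := isProbabilityMeasure_gameMeasure α β h0 h1
  have hAB := isCorrelatedPair_cellA_cellB h0 h1
  have hBA := isCorrelatedPair_cellB_cellA h0 h1
  have hKα : K ≤ Fintype.card α := hK ▸ min_le_left _ _
  have hKβ : K ≤ Fintype.card β := hK ▸ min_le_right _ _
  have hKα' : (K : ℝ) ≤ Fintype.card α := by exact_mod_cast hKα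
  have hKβ' : (K : ℝ) ≤ Fintype.card β := by exact_mod_cast hKβ
  have hkK : 2 * ((k + 1 : ℕ) : ℝ) ≤ K := by exact_mod_cast hk
  have hc : Function.Injective2 (Prod.mk : α → β → α × β) := fun _ _ _ _ h => Prod.ext_iff.1 h
  have hc' : Function.Injective2 fun (y : β) (x : α) => (x, y) := fun _ _ _ _ h =>
    (Prod.ext_iff.1 h).symm
  -- One step more than the path bound requires, so that a path of `k` corners remains after
  -- dropping `b 0` when the players are exchanged.
  set n : ℕ := k + 1 with hn
  set δ : ℝ := Real.exp (4 * n ^ 2 / K) * (2 * n / K)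
  let μ := gameMeasure α β p
  let row : ℕ → Set (GameSample α β) := fun j =>
    {ω | ∃ a : Fin j → α, ∃ b : Fin (j + 1) → β, ∃ l : Fin j, a.Injective ∧ b.Injective ∧
      b 0 = x₀.2 ∧ (l : ℕ) + 1 ≠ j ∧
      (∀ i x, cellA (ω (x, b i)) ≤
        cellA (ω (Fin.snoc (α := fun _ => α) a (a l) i, b i))) ∧
      ∀ i y, cellB (ω (a i, y)) ≤ cellB (ω (a i, b i.succ))}
  let col : ℕ → Set (GameSample α β) := fun j =>
    {ω | ∃ a : Fin (j + 1) → α, ∃ b : Fin (j + 1) → β, ∃ l : Fin j, a.Injective ∧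
      b.Injective ∧ b 0 = x₀.2 ∧
      (∀ i x, cellA (ω (x, b i)) ≤ cellA (ω (a i, b i))) ∧
      ∀ i y, cellB (ω (a i, y)) ≤
        cellB (ω (a i, Fin.snoc (α := fun _ => β) (fun i : Fin j => b i.succ)
          (b l.castSucc) i))}
  let long : Set (GameSample α β) := {ω | ∃ a b, Set.InjOn a (Set.Iio n) ∧
    Set.InjOn b (Set.Iio (n + 1)) ∧ (∀ t x, cellA (ω (x, b t)) ≤ cellA (ω (a t, b t))) ∧
    ∀ t y, cellB (ω (a t, y)) ≤ cellB (ω (a t, b (t + 1)))}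
  have hrow : ∀ j < n, μ.real (row j) ≤ δ := fun j hj =>
    (hAB.measureReal_row_return_le hBA h0 h1 hc x₀.2 j (by omega) (by omega)).trans
      (row_return_bound hj hKα' hKβ' hkK)
  have hcol : ∀ j < n, μ.real (col j) ≤ δ := fun j hj =>
    (hAB.measureReal_column_return_le hBA h0 h1 hc x₀.2 j (by omega) (by omega)).trans
      (column_return_bound hj hKα' hKβ' hkK)
  have hlong : μ.real long ≤ Real.exp (4 * n ^ 2 / K) * (K * Real.exp (-(p * k / 3))) := by
    rcases le_total (Fintype.card β) (Fintype.card α) with hle | hle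
    · rw [min_eq_right hle] at hK
      have h := hAB.measureReal_path_le h0 h1 hc k (by omega) (by omega)
      have hb := path_bound (n := n) (k := k) (A := Fintype.card α) (B := Fintype.card β) (by omega)
        h0 h1 (by exact_mod_cast hle) (by rw [← hK]; exact hkK)
      rw [hK]
      refine (measureReal_mono ?_).trans (h.trans hb)
      rintro ω ⟨a, b, ha, hb, h1, h2⟩
      refine ⟨fun i => a i, fun i => b i, ?_, ?_, fun i => h1 i, fun i => h2 i⟩
      · exact fun i j e => Fin.ext (ha (show (i : ℕ) < n by omega) (show (j : ℕ) < n by omega) e)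
      · exact fun i j e => Fin.ext
          (hb (show (i : ℕ) < n + 1 by omega) (show (j : ℕ) < n + 1 by omega) e)
    · rw [min_eq_left hle] at hK
      have h := hBA.measureReal_path_le h0 h1 hc' k (by omega) (by omega)
      have hb := path_bound (n := n) (k := k) (A := Fintype.card β) (B := Fintype.card α) (by omega)
        h0 h1 (by exact_mod_cast hle) (by rw [← hK]; exact hkK)
      rw [hK]
      refine (measureReal_mono ?_).trans (h.trans hb)
      rintro ω ⟨a, b, ha, hb, h1, h2⟩
      -- With roles exchanged the path starts at `a 0`, and its responses are `b 1, b 2, …`.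
      refine ⟨fun i => b (i + 1), fun i => a i, ?_, ?_, fun i => h2 i, fun i => h1 (i + 1)⟩
      · exact fun i j e => Fin.ext (Nat.succ_injective
          (hb (show (i : ℕ) + 1 < n + 1 by omega) (show (j : ℕ) + 1 < n + 1 by omega) e))
      · exact fun i j e => Fin.ext (ha (show (i : ℕ) < n by omega) (show (j : ℕ) < n by omega) e)
  have hsub : {ω | (randomGame ω).nashTime x₀ = ⊤} ⊆
      long ∪ ⋃ j ∈ Finset.range n, (row j ∪ col j) := by
    intro ω hω
    obtain ⟨a, b, hb0, hA, hB, ha, hb⟩ := (randomGame ω).exists_best_response_sequences hω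
    have hA' : ∀ t x, cellA (ω (x, b t)) ≤ cellA (ω (a t, b t)) := hA
    have hB' : ∀ t y, cellB (ω (a t, y)) ≤ cellB (ω (a t, b (t + 1))) := hB
    rcases injOn_or_exists_return ha hb n with ⟨h1, h2⟩ | ⟨j, hj, h⟩
    · exact .inl ⟨a, b, h1, h2, hA', hB'⟩
    · refine .inr (Set.mem_biUnion (Finset.mem_coe.2 (Finset.mem_range.2 hj)) ?_)
      rcases h with ⟨h1, h2, l, hl, hlj, e⟩ | ⟨h1, h2, l, hl, e⟩
      · refine .inl ⟨fun i => a i, fun i => b i, ⟨l, hl⟩, fun i j e => Fin.ext (h1 i.2 j.2 e),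
          fun i j e => Fin.ext (h2 i.2 j.2 e), hb0, hlj, fun i => ?_, fun i => hB' i⟩
        refine Fin.lastCases ?_ (fun i => ?_) i
        · simpa [← e] using hA' j
        · simpa using hA' i
      · refine .inr ⟨fun i => a i, fun i => b i, ⟨l, hl⟩, fun i j e => Fin.ext (h1 i.2 j.2 e),
          fun i j e => Fin.ext (h2 i.2 j.2 e), hb0, fun i => hA' i, fun i => ?_⟩
        refine Fin.lastCases ?_ (fun i => ?_) i
        · simpa [← e] using hB' j
        · simpa using hB' i
  calc μ.real {ω | (randomGame ω).nashTime x₀ = ⊤}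
      ≤ μ.real long + ∑ j ∈ Finset.range n, μ.real (row j ∪ col j) :=
        (measureReal_mono hsub).trans ((measureReal_union_le _ _).trans
          (add_le_add_right (measureReal_biUnion_finset_le _ _) _))
    _ ≤ Real.exp (4 * n ^ 2 / K) * (K * Real.exp (-(p * k / 3))) +
          ∑ j ∈ Finset.range n, (δ + δ) := by
        refine add_le_add hlong (Finset.sum_le_sum fun j hj => ?_)
        have hj := Finset.mem_range.1 hj
        exact (measureReal_union_le _ _).trans (add_le_add (hrow j hj) (hcol j hj))
    _ = _ := by
        rw [Finset.sum_const, Finset.card_range, nsmul_eq_mul]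
        simp only [δ, hn]
        push_cast
        ring

theorem tendsto_bound {K : ℕ → ℕ} (hK : Tendsto K atTop atTop) {p : ℕ → ℝ}
    (hp_pos : ∀ n, 0 < p n)
    (hp_log : Tendsto (fun n => Real.log (p n) / Real.log (K n)) atTop (𝓝 0)) :
    ∃ k : ℕ → ℕ, (∀ᶠ n in atTop, 2 * (k n + 1) ≤ K n) ∧
      Tendsto (fun n => Real.exp (4 * ((k n : ℝ) + 1) ^ 2 / K n) *
        (4 * ((k n : ℝ) + 1) ^ 2 / K n + K n * Real.exp (-(p n * k n / 3)))) atTop (𝓝 0) := by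
  -- With `K = x ^ 8` and `k` about `x ^ 2`, the term `k ^ 2 / K` is of order `x ^ (-4)`. Eventually
  -- `p ≥ 1 / x`, so `p * k ≥ x` and `K * exp (-p k / 3) ≤ x ^ 8 * exp (-x / 3)`.
  set x : ℕ → ℝ := fun n => (K n : ℝ) ^ (1 / 8 : ℝ) with hx
  have hKr : Tendsto (fun n => (K n : ℝ)) atTop atTop := tendsto_natCast_atTop_atTop.comp hK
  have hxt : Tendsto x atTop atTop := (tendsto_rpow_atTop (by norm_num)).comp hKr
  have hx8 : ∀ n, (K n : ℝ) = x n ^ 8 := fun n => by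
    rw [hx, ← Real.rpow_natCast, ← Real.rpow_mul (Nat.cast_nonneg _)]
    norm_num
  refine ⟨fun n => ⌈x n ^ 2⌉₊, ?_, ?_⟩
  · filter_upwards [hxt.eventually_ge_atTop 2] with n hn
    have h1 := (Nat.ceil_lt_add_one (sq_nonneg (x n))).le
    have h2 : x n ^ 8 = x n ^ 2 * x n ^ 6 := by ring
    have h3 : (2 : ℝ) ^ 2 ≤ x n ^ 2 := by gcongr
    have h4 : (2 : ℝ) ^ 6 ≤ x n ^ 6 := by gcongr
    have : (2 * (⌈x n ^ 2⌉₊ + 1) : ℝ) ≤ K n := by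
      rw [hx8, h2]
      nlinarith
    exact_mod_cast this
  have hz : Tendsto (fun n => 4 * ((⌈x n ^ 2⌉₊ : ℝ) + 1) ^ 2 / K n) atTop (𝓝 0) := by
    have hb : Tendsto (fun n => 36 * (x n ^ 4)⁻¹) atTop (𝓝 0) := by
      have := (tendsto_inv_atTop_zero.comp ((tendsto_pow_atTop (n := 4) (by norm_num)).comp hxt))
      simpa using this.const_mul 36
    refine squeeze_zero' (.of_forall fun n => by positivity) ?_ hb
    filter_upwards [hxt.eventually_ge_atTop 2] with n hn
    have h1 := (Nat.ceil_lt_add_one (sq_nonneg (x n))).le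
    have h3 : (2 : ℝ) ^ 2 ≤ x n ^ 2 := by gcongr
    have h5 : ((⌈x n ^ 2⌉₊ : ℝ) + 1) ≤ 3 * x n ^ 2 := by linarith
    rw [hx8, ← div_eq_mul_inv, div_le_div_iff₀ (by positivity) (by positivity)]
    calc 4 * ((⌈x n ^ 2⌉₊ : ℝ) + 1) ^ 2 * x n ^ 4 ≤ 4 * (3 * x n ^ 2) ^ 2 * x n ^ 4 := by gcongr
      _ = 36 * x n ^ 8 := by ring
  have hw : Tendsto (fun n => K n * Real.exp (-(p n * ⌈x n ^ 2⌉₊ / 3))) atTop (𝓝 0) := by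
    have hb : Tendsto (fun n => 3 ^ 8 * ((x n / 3) ^ 8 * Real.exp (-(x n / 3)))) atTop (𝓝 0) := by
      have := (Real.tendsto_pow_mul_exp_neg_atTop_nhds_zero 8).comp
        (hxt.atTop_div_const (show (0 : ℝ) < 3 by norm_num))
      simpa using this.const_mul (3 ^ 8)
    refine squeeze_zero' (.of_forall fun n => by positivity) ?_ hb
    filter_upwards [hxt.eventually_ge_atTop 2, hKr.eventually_gt_atTop 1,
      hp_log.eventually (lt_mem_nhds (show (-(1 / 8) : ℝ) < 0 by norm_num))] with n hn hK1 hlog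
    have hx0 : 0 < x n := by linarith
    have hlK : 0 < Real.log (K n) := Real.log_pos hK1
    have hpx : 1 / x n ≤ p n := by
      rw [lt_div_iff₀ hlK] at hlog
      have hlx : Real.log (x n) = 1 / 8 * Real.log (K n) := by
        rw [hx, Real.log_rpow (by linarith)]
      rw [← Real.log_le_log_iff (by positivity) (hp_pos n), one_div, Real.log_inv, hlx]
      linarith
    have h1 : x n ≤ p n * ⌈x n ^ 2⌉₊ := by
      calc x n = 1 / x n * x n ^ 2 := by field_simp
        _ ≤ p n * ⌈x n ^ 2⌉₊ :=
          mul_le_mul hpx (Nat.le_ceil _) (by positivity) (hp_pos n).le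
    calc K n * Real.exp (-(p n * ⌈x n ^ 2⌉₊ / 3)) ≤ K n * Real.exp (-(x n / 3)) := by gcongr
      _ = _ := by rw [hx8]; ring
  have he := Real.continuous_exp.continuousAt.tendsto.comp hz
  simpa using he.mul (hz.add hw)

theorem mainTheorem1 (KA KB : ℕ → ℕ) [∀ n, NeZero (KA n)] [∀ n, NeZero (KB n)]
    (hKA : Tendsto KA atTop atTop) (hKB : Tendsto KB atTop atTop)
    (p : ℕ → ℝ) (hp_pos : ∀ n, 0 < p n) (hp_le : ∀ n, p n ≤ 1)
    (hp_log : Tendsto (fun n => Real.log (p n) / Real.log ((min (KA n) (KB n) : ℕ) : ℝ))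
      atTop (𝓝 0)) :
    Tendsto
      (fun n => gameMeasure (Fin (KA n)) (Fin (KB n)) (p n)
        {ω | (randomGame ω).nashTime ((0 : Fin (KA n)), (0 : Fin (KB n))) = ⊤})
      atTop (𝓝 0) := by
  have hK : Tendsto (fun n => min (KA n) (KB n)) atTop atTop :=
    tendsto_atTop.2 fun m => by
      filter_upwards [hKA.eventually_ge_atTop m, hKB.eventually_ge_atTop m] with n h1 h2
      exact le_min h1 h2
  obtain ⟨k, hk, hlim⟩ := tendsto_bound hK hp_pos hp_log
  have := fun n => isProbabilityMeasure_gameMeasure (Fin (KA n)) (Fin (KB n)) (hp_pos n).le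
    (hp_le n)
  rw [← ENNReal.tendsto_toReal_iff (fun n => measure_ne_top _ _) ENNReal.zero_ne_top]
  refine squeeze_zero' (.of_forall fun n => ENNReal.toReal_nonneg) ?_ hlim
  filter_upwards [hk] with n hn
  exact measureReal_nashTime_eq_top_le (hp_pos n).le (hp_le n) _ (by simp) hn
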